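/- Let $\mathbb G=(C(\mathbb G),\Delta)$ be a compact quantum group: $C(\mathbb G)\neq 0$ is a unital $C^*$-algebra and $\Delta:C(\mathbb G)\to C(\mathbb G)\otimes_{\min}C(\mathbb G)$ is a coassociative unital $*$-homomorphism such that $\Delta(C(\mathbb G))(C(\mathbb G)\otimes 1)$ and $\Delta(C(\mathbb G))(1\otimes C(\mathbb G))$ span dense subspaces. A finite-dimensional unitary representation $u$ is a unitary matrix $(u_{ij})\in B(H_u)\otimes C(\mathbb G)$ (in a fixed orthonormal basis) with $\Delta(u_{ij})=\sum_k u_{ik}\otimes u_{kj}$; put $u^c=(u_{ij}^*)$. Let $Q_u$ be the positive invertible matrix such that $\overline u=(Q_u^{1/2}\otimes 1)u^c(Q_u^{-1/2}\otimes 1)$ is unitary and $\mathrm{Tr}(Q_u\,\cdot)=\mathrm{Tr}(Q_u^{-1}\,\cdot)$ on the self-intertwiners of $u^c$, and let $d_u=\mathrm{Tr}(Q_u)$. Assume that $\mathbb G$ is of Kac type, i.e. $Q_u=\mathrm{Id}$ for every finite-dimensional unitary representation $u$. The tensor product $u\otimes v$ of representations has entries $u_{ij}v_{kl}$. For irreducible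 unitary representations $\alpha,\beta,\gamma$ with $\alpha\subseteq\beta\otimes\gamma$, a Clebsch–Gordan map $\Phi^{\alpha\to\beta}_\gamma:B(H_\alpha)\to B(H_\beta)$ is a map $$\Phi^{\alpha\to\beta}_\gamma(X)=(\mathrm{id}\otimes \mathrm{Tr}(Q_\gamma\,\cdot\,))(vXv^*),$$ where $v\in\mathrm{Hom}(\alpha,\beta\otimes\gamma)$ is an isometric intertwiner. For a linear map $\Phi:B(H_\alpha)\to B(H_\beta)$, let $\Phi^*:B(H_\beta)\to B(H_\alpha)$ be its adjoint for the trace pairing, $\mathrm{Tr}(\Phi^*(Y)X)=\mathrm{Tr}(Y\Phi(X))$. The map $\Phi$ is $(\alpha,\beta)$-covariant if $(\Phi\otimes\mathrm{id})(u^\alpha(X\otimes1)(u^\alpha)^*)=u^\beta(\Phi(X)\otimes1)(u^\beta)^*$ for all $X\in B(H_\alpha)$. Let $\mathrm{CPTPCov}(\alpha,\beta)$ and $\mathrm{UCPCov}(\alpha,\beta)$ be the sets of $(\alpha,\beta)$-covariant maps that are completely positive and trace-preserving, respectively completely positive and unital. **Theorem.** Let $\mathbb G$ be of Kac type. 1.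 Let $\alpha,\beta,\gamma$ be irreducible unitary representations, let $\overline\gamma$ stand for any irreducible unitary representation equivalent to the conjugate of $\gamma$, and suppose that $\overline\gamma$ occurs exactly once in a decomposition of $\overline\alpha\otimes\beta$ into irreducible unitary representations. Then Clebsch–Gordan maps $\Phi^{\alpha\to\beta}_\gamma$ and $\Phi^{\beta\to\alpha}_{\overline\gamma}$ exist and, whatever isometric intertwiners are used to define them, $$\left(\Phi^{\alpha\to\beta}_\gamma\right)^*=\frac{d_\alpha}{d_\beta}\,\Phi^{\beta\to\alpha}_{\overline\gamma}.$$ 2. Let $\alpha,\beta$ be irreducible unitary representations and $\Phi:B(H_\alpha)\to B(H_\beta)$ a linear map. Then - $\Phi$ is $(\alpha,\beta)$-covariant if and only if $\Phi^*$ is $(\beta,\alpha)$-covariant; - $\Phi\in\mathrm{CPTPCov}(\alpha,\beta)$ if and only if $\Phi^*\in\mathrm{UCPCov}(\beta,\alpha)$; - $\Phi\in\mathrm{CPTPCov}(\alpha,\beta)$ if and only if $\frac{d_\beta}{d_\alpha}\Phi^*\in\mathrm{CPTPCov}(\beta,\alpha)$. -/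

import Mathlib

open scoped ENNReal ComplexOrder TensorProduct Kronecker

noncomputable section

/-! ### The minimal tensor product of unital C*-algebras

`MinTensor A B` is the completion of the algebraic tensor product in the spatial norm
`‖x‖ = sup ‖(π_φ ⊗ π_ψ)(x)‖`, where `φ`, `ψ` run over the states of `A`, `B` and `π_φ`, `π_ψ` are
their GNS representations. It is realised inside the bounded families of operators on the Hilbert
space tensor products `H_φ ⊗ H_ψ`, as the C*-subalgebra generated by the elementary tensors. -/

namespace CQG

universe u v

section MinTensor

attribute [local instance] CStarAlgebra.spectralOrder CStarAlgebra.spectralOrderedRing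

/-- The states of a unital C*-algebra (for its usual order). -/
def StateSpace (A : Type u) [CStarAlgebra A] : Type u := {φ : A →ₚ[ℂ] ℂ // φ 1 = 1}

/-- The GNS Hilbert space of a state. -/
abbrev StateSpace.Hilb {A : Type u} [CStarAlgebra A] (φ : StateSpace A) : Type u := φ.1.GNS

/-- The GNS representation of a state. -/
def StateSpace.rep {A : Type u} [CStarAlgebra A] (φ : StateSpace A) :
    A →⋆ₐ[ℂ] (φ.Hilb →L[ℂ] φ.Hilb) := φ.1.gnsStarAlgHom

theorem StateSpace.norm_rep_le {A : Type u} [CStarAlgebra A] (φ : StateSpace A) (a : A) :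
    ‖φ.rep a‖ ≤ ‖a‖ := NonUnitalStarAlgHom.norm_apply_le φ.rep a

instance StateSpace.nontrivial_hilb {A : Type u} [CStarAlgebra A] (φ : StateSpace A) :
    Nontrivial φ.Hilb := by
  refine ⟨((φ.1.toPreGNS 1 : φ.1.PreGNS) : φ.Hilb), 0, fun h => ?_⟩
  have h1 : ‖((φ.1.toPreGNS 1 : φ.1.PreGNS) : φ.Hilb)‖ = 0 := by rw [h, norm_zero]
  rw [UniformSpace.Completion.norm_coe, PositiveLinearMap.preGNS_norm_def] at h1
  simp [φ.2] at h1

/-- The Hilbert space tensor product `H_φ ⊗ H_ψ`. -/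
abbrev TensorHilb {A : Type u} {B : Type v} [CStarAlgebra A] [CStarAlgebra B]
    (p : StateSpace A × StateSpace B) : Type (max u v) :=
  UniformSpace.Completion (p.1.Hilb ⊗[ℂ] p.2.Hilb)

instance TensorHilb.nontrivial {A : Type u} {B : Type v} [CStarAlgebra A] [CStarAlgebra B]
    (p : StateSpace A × StateSpace B) : Nontrivial (TensorHilb p) := by
  obtain ⟨x, hx⟩ := exists_ne (0 : p.1.Hilb)
  obtain ⟨y, hy⟩ := exists_ne (0 : p.2.Hilb)
  refine ⟨((x ⊗ₜ[ℂ] y : p.1.Hilb ⊗[ℂ] p.2.Hilb) : TensorHilb p), 0, fun h => ?_⟩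
  have h1 : ‖((x ⊗ₜ[ℂ] y : p.1.Hilb ⊗[ℂ] p.2.Hilb) : TensorHilb p)‖ = 0 := by rw [h, norm_zero]
  rw [UniformSpace.Completion.norm_coe, TensorProduct.norm_tmul] at h1
  simp [hx, hy] at h1

/-- Bounded operators on `H_φ ⊗ H_ψ`. -/
abbrev TensorOp {A : Type u} {B : Type v} [CStarAlgebra A] [CStarAlgebra B]
    (p : StateSpace A × StateSpace B) : Type (max u v) := TensorHilb p →L[ℂ] TensorHilb p

instance TensorOp.cstarAlgebra {A : Type u} {B : Type v} [CStarAlgebra A] [CStarAlgebra B]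
    (p : StateSpace A × StateSpace B) : CStarAlgebra (TensorOp p) := inferInstance

/-- The operator `π_φ(a) ⊗ π_ψ(b)` on `H_φ ⊗ H_ψ`. -/
def tensorOp {A : Type u} {B : Type v} [CStarAlgebra A] [CStarAlgebra B] (a : A) (b : B)
    (p : StateSpace A × StateSpace B) : TensorOp p :=
  (TensorProduct.mapL (p.1.rep a) (p.2.rep b)).completion

theorem norm_tensorOp_le {A : Type u} {B : Type v} [CStarAlgebra A] [CStarAlgebra B] (a : A)
    (b : B) (p : StateSpace A × StateSpace B) : ‖tensorOp a b p‖ ≤ ‖a‖ * ‖b‖ := by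
  refine ContinuousLinearMap.opNorm_le_bound _ (by positivity) fun x => ?_
  induction x using UniformSpace.Completion.induction_on with
  | hp =>
    refine isClosed_le (by fun_prop) (by fun_prop)
  | ih x =>
    rw [tensorOp, ContinuousLinearMap.completion_apply_coe, UniformSpace.Completion.norm_coe,
      UniformSpace.Completion.norm_coe]
    refine (ContinuousLinearMap.le_opNorm _ x).trans ?_
    gcongr
    refine (TensorProduct.norm_mapL_le _ _).trans ?_
    gcongr
    · exact p.1.norm_rep_le a
    · exact p.2.norm_rep_le b

instance instCStarAlgebraLpInfty {I : Type*} {E : I → Type*} [∀ i, Nontrivial (E i)]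
    [∀ i, CStarAlgebra (E i)] : CStarAlgebra (lp E ∞) where

/-- The C*-algebra of bounded families of operators on the spaces `H_φ ⊗ H_ψ`. -/
abbrev TensorAmbient (A : Type u) (B : Type v) [CStarAlgebra A] [CStarAlgebra B] :
    Type (max u v) := lp (fun p : StateSpace A × StateSpace B => TensorOp p) ∞

/-- The elementary tensor `a ⊗ b`, as the family of operators `π_φ(a) ⊗ π_ψ(b)`. -/
def ambientTmul {A : Type u} {B : Type v} [CStarAlgebra A] [CStarAlgebra B] (a : A) (b : B) :
    TensorAmbient A B :=
  ⟨tensorOp a b, memℓp_infty ⟨‖a‖ * ‖b‖, by rintro _ ⟨p, rfl⟩; exact norm_tensorOp_le a b p⟩⟩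

/-- The C*-subalgebra generated by the elementary tensors. -/
def minTensorSubalgebra (A : Type u) (B : Type v) [CStarAlgebra A] [CStarAlgebra B] :
    StarSubalgebra ℂ (TensorAmbient A B) :=
  (StarAlgebra.adjoin ℂ {x | ∃ (a : A) (b : B), x = ambientTmul a b}).topologicalClosure

/-- The minimal (spatial) tensor product of two unital C*-algebras. -/
def MinTensor (A : Type u) (B : Type v) [CStarAlgebra A] [CStarAlgebra B] : Type (max u v) :=
  minTensorSubalgebra A B

instance (A : Type u) (B : Type v) [CStarAlgebra A] [CStarAlgebra B] :
    CStarAlgebra (MinTensor A B) :=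
  StarSubalgebra.cstarAlgebra (minTensorSubalgebra A B)
    (h_closed := StarSubalgebra.isClosed_topologicalClosure _)

/-- The elementary tensor `a ⊗ b` in the minimal tensor product. -/
def mtmul {A : Type u} {B : Type v} [CStarAlgebra A] [CStarAlgebra B] (a : A) (b : B) :
    MinTensor A B :=
  ⟨ambientTmul a b, StarSubalgebra.le_topologicalClosure _
    (StarAlgebra.subset_adjoin ℂ _ ⟨a, b, rfl⟩)⟩

end MinTensor

/-! ### Compact quantum groups -/

/-- A compact quantum group `𝔾` with underlying unital C*-algebra `A = C(𝔾)`. -/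
structure CompactQuantumGroup (A : Type u) [CStarAlgebra A] where
  /-- the comultiplication, a unital *-homomorphism -/
  comul : A →⋆ₐ[ℂ] MinTensor A A
  /-- `(Δ ⊗ id) Δ = (id ⊗ Δ) Δ`, where `Δ ⊗ id`, `id ⊗ Δ` and the associativity isomorphism are the
  *-homomorphisms determined by their values on elementary tensors -/
  coassoc :
    ∃ (comulId : MinTensor A A →⋆ₐ[ℂ] MinTensor (MinTensor A A) A)
      (idComul : MinTensor A A →⋆ₐ[ℂ] MinTensor A (MinTensor A A))
      (assoc : MinTensor (MinTensor A A) A ≃⋆ₐ[ℂ] MinTensor A (MinTensor A A)),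
      (∀ a b, comulId (mtmul a b) = mtmul (comul a) b) ∧
      (∀ a b, idComul (mtmul a b) = mtmul a (comul b)) ∧
      (∀ a b c, assoc (mtmul (mtmul a b) c) = mtmul a (mtmul b c)) ∧
      ∀ a, assoc (comulId (comul a)) = idComul (comul a)
  /-- the elements `Δ(a)(b ⊗ 1)` span a dense subspace -/
  dense_left :
    Dense (Submodule.span ℂ {x | ∃ a b : A, x = comul a * mtmul b 1} : Set (MinTensor A A))
  /-- the elements `Δ(a)(1 ⊗ b)` span a dense subspace -/
  dense_right :
    Dense (Submodule.span ℂ {x | ∃ a b : A, x = comul a * mtmul 1 b} : Set (MinTensor A A))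

/-! ### Finite-dimensional representations

A representation on a Hilbert space with a fixed orthonormal basis indexed by `ι` is a matrix
`u = (u i j)` over `A`; `B(H_u)` is `Matrix ι ι ℂ`. -/

section Rep

variable {A : Type u} [CStarAlgebra A]
variable {ι κ μ : Type} [Fintype ι] [DecidableEq ι] [Fintype κ] [DecidableEq κ]
  [Fintype μ] [DecidableEq μ]

/-- `X ⊗ 1` for a scalar matrix `X`. -/
def scalarMat (A : Type u) [CStarAlgebra A] {ι κ : Type} (X : Matrix κ ι ℂ) : Matrix κ ι A :=
  X.map (algebraMap ℂ A)

/-- `u` is a finite-dimensional representation of `𝔾`. -/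
def IsRep (G : CompactQuantumGroup A) (u : Matrix ι ι A) : Prop :=
  IsUnit u ∧ ∀ i j, G.comul (u i j) = ∑ k, mtmul (u i k) (u k j)

/-- `u` is a unitary representation of `𝔾`. -/
def IsUnitaryRep (G : CompactQuantumGroup A) (u : Matrix ι ι A) : Prop :=
  IsRep G u ∧ u ∈ unitary (Matrix ι ι A)

/-- `T` is an intertwiner from `u` to `v`: `v (T ⊗ 1) = (T ⊗ 1) u`. -/
def IsIntertwiner (u : Matrix ι ι A) (v : Matrix κ κ A) (T : Matrix κ ι ℂ) : Prop :=
  v * scalarMat A T = scalarMat A T * u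

/-- `u` is irreducible: the representation space is nonzero and `Hom(u, u) = ℂ · Id`. -/
def IsIrreducible (u : Matrix ι ι A) : Prop :=
  Nonempty ι ∧ ∀ T : Matrix ι ι ℂ, IsIntertwiner u u T → ∃ c : ℂ, T = c • (1 : Matrix ι ι ℂ)

/-- `u` is an irreducible unitary representation, that is, a representative of a class in
`Irr(𝔾)`. -/
def IsIrrep (G : CompactQuantumGroup A) (u : Matrix ι ι A) : Prop :=
  IsUnitaryRep G u ∧ IsIrreducible u

/-- `u` and `v` are equivalent: `Hom(u, v)` contains an invertible operator. -/
def RepEquiv (u : Matrix ι ι A) (v : Matrix κ κ A) : Prop :=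
  ∃ (T : Matrix κ ι ℂ) (S : Matrix ι κ ℂ), IsIntertwiner u v T ∧ T * S = 1 ∧ S * T = 1

/-- The tensor product of representations, with entries `u i j * v k l`. -/
def repTensor (u : Matrix ι ι A) (v : Matrix κ κ A) : Matrix (ι × κ) (ι × κ) A := u ⊗ₖ v

/-- The contragredient `u^c`, with entries `(u i j)*`. -/
def contragredient (u : Matrix ι ι A) : Matrix ι ι A := u.map star

open scoped MatrixOrder in
/-- `(Q^{1/2} ⊗ 1) u^c (Q^{-1/2} ⊗ 1)`. -/
def conjugateBy (Q : Matrix ι ι ℂ) (u : Matrix ι ι A) : Matrix ι ι A :=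
  scalarMat A (CFC.sqrt Q) * contragredient u * scalarMat A (CFC.sqrt Q)⁻¹

/-- The properties that determine the matrix `Q_u` of a unitary representation `u`: it is positive
and invertible, `(Q^{1/2} ⊗ 1) u^c (Q^{-1/2} ⊗ 1)` is unitary, and the functionals `Tr(Q ·)` and
`Tr(Q⁻¹ ·)` coincide on the operators that intertwine `u^c` with itself. -/
def IsQMatrix (u : Matrix ι ι A) (Q : Matrix ι ι ℂ) : Prop :=
  Q.PosDef ∧ conjugateBy Q u ∈ unitary (Matrix ι ι A) ∧
    ∀ X : Matrix ι ι ℂ, IsIntertwiner (contragredient u) (contragredient u) X →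
      (Q * X).trace = (Q⁻¹ * X).trace

/-- The matrix `Q_u`. -/
def qMatrix (u : Matrix ι ι A) : Matrix ι ι ℂ := Classical.epsilon (IsQMatrix u)

/-- The quantum dimension `d_u = Tr(Q_u)`. -/
def quantumDim (u : Matrix ι ι A) : ℂ := (qMatrix u).trace

/-- The conjugate representation `ū = (Q_u^{1/2} ⊗ 1) u^c (Q_u^{-1/2} ⊗ 1)`. -/
def conjugateRep (u : Matrix ι ι A) : Matrix ι ι A := conjugateBy (qMatrix u) u

/-- `𝔾` is of Kac type: the matrix `Q_u` is the identity for every unitary representation `u`. -/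
def IsKac (G : CompactQuantumGroup A) : Prop :=
  ∀ (ι : Type) [Fintype ι] [DecidableEq ι] (u : Matrix ι ι A), IsUnitaryRep G u → IsQMatrix u 1

/-- The irreducible representation `u` occurs in `v` exactly once: `v` is equivalent to a direct sum
of irreducible unitary representations, precisely one of which is equivalent to `u`. -/
def OccursOnce (G : CompactQuantumGroup A) (u : Matrix ι ι A) (v : Matrix κ κ A) : Prop :=
  ∃ (N : ℕ) (n : Fin N → ℕ) (w : ∀ j, Matrix (Fin (n j)) (Fin (n j)) A),
    (∀ j, IsIrrep G (w j)) ∧ RepEquiv v (Matrix.blockDiagonal' w) ∧ ∃! j, RepEquiv u (w j)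

/-! ### Linear maps between matrix algebras -/

/-- `Φ ⊗ id` on `B(H) ⊗ A`. -/
def tensorId (Φ : Matrix ι ι ℂ →ₗ[ℂ] Matrix κ κ ℂ) (M : Matrix ι ι A) : Matrix κ κ A :=
  fun k l => ∑ i, ∑ j, (Φ (Matrix.single i j 1) k l) • M i j

/-- `Φ` is `𝔾_(u,v)`-covariant: `(Φ ⊗ id)(u (X ⊗ 1) u*) = v (Φ(X) ⊗ 1) v*` for all `X`. -/
def IsCovariant (u : Matrix ι ι A) (v : Matrix κ κ A)
    (Φ : Matrix ι ι ℂ →ₗ[ℂ] Matrix κ κ ℂ) : Prop :=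
  ∀ X : Matrix ι ι ℂ, tensorId Φ (u * scalarMat A X * star u) = v * scalarMat A (Φ X) * star v

/-- `Φ` is completely positive: `id ⊗ Φ` preserves positivity on `M_n ⊗ B(H)` for every `n`. -/
def IsCP (Φ : Matrix ι ι ℂ →ₗ[ℂ] Matrix κ κ ℂ) : Prop :=
  ∀ (n : ℕ) (M : Matrix (Fin n × ι) (Fin n × ι) ℂ), M.PosSemidef →
    (Matrix.of fun (x y : Fin n × κ) =>
      Φ (Matrix.of fun i j => M (x.1, i) (y.1, j)) x.2 y.2).PosSemidef

/-- `Φ` is trace-preserving. -/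
def IsTP (Φ : Matrix ι ι ℂ →ₗ[ℂ] Matrix κ κ ℂ) : Prop := ∀ X, (Φ X).trace = X.trace

/-- The covariant channels in the Schroedinger picture. -/
def CPTPCov (u : Matrix ι ι A) (v : Matrix κ κ A) : Set (Matrix ι ι ℂ →ₗ[ℂ] Matrix κ κ ℂ) :=
  {Φ | IsCP Φ ∧ IsTP Φ ∧ IsCovariant u v Φ}

/-- The covariant channels in the Heisenberg picture. -/
def UCPCov (u : Matrix ι ι A) (v : Matrix κ κ A) : Set (Matrix ι ι ℂ →ₗ[ℂ] Matrix κ κ ℂ) :=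
  {Φ | IsCP Φ ∧ Φ 1 = 1 ∧ IsCovariant u v Φ}

/-- The adjoint `Φ*` for the trace pairing `⟨X, Y⟩ = Tr(XY)`. -/
def traceAdjoint (Φ : Matrix ι ι ℂ →ₗ[ℂ] Matrix κ κ ℂ) : Matrix κ κ ℂ →ₗ[ℂ] Matrix ι ι ℂ where
  toFun Y := Matrix.of fun i j => (Y * Φ (Matrix.single j i 1)).trace
  map_add' X Y := by ext i j; simp [add_mul]
  map_smul' c X := by ext i j; simp

/-- `Φ*` is characterised by `⟨Φ*(Y), X⟩ = ⟨Y, Φ(X)⟩`. -/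
theorem trace_traceAdjoint_mul (Φ : Matrix ι ι ℂ →ₗ[ℂ] Matrix κ κ ℂ) (Y : Matrix κ κ ℂ)
    (X : Matrix ι ι ℂ) : (traceAdjoint Φ Y * X).trace = (Y * Φ X).trace := by
  induction X using Matrix.induction_on' with
  | h_zero => simp
  | h_add p q hp hq => simp [mul_add, hp, hq]
  | h_std_basis i j x =>
    have h : Matrix.single i j x = x • Matrix.single i j (1 : ℂ) := by simp
    rw [h, map_smul, Matrix.mul_smul, Matrix.mul_smul, Matrix.trace_smul, Matrix.trace_smul,
      Matrix.trace_mul_single]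
    simp [traceAdjoint]

/-! ### Clebsch-Gordan maps -/

/-- `(id ⊗ Tr_Q)(Z)` for `Z ∈ B(H ⊗ K)`, where `Tr_Q(X) = Tr(Q X)`. -/
def partialQTrace (Q : Matrix κ κ ℂ) (Z : Matrix (ι × κ) (ι × κ) ℂ) : Matrix ι ι ℂ :=
  fun i j => Matrix.trace (Q * Matrix.of fun k l => Z (i, k) (j, l))

/-- `Φ` is the Clebsch-Gordan map `Φ^{α → β}_γ` for the irreducible representations `a`, `b`, `c` in
the classes `α`, `β`, `γ`: `Φ(X) = (id ⊗ Tr_{Q_γ})(V X V*)` for an isometric intertwiner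
`V ∈ Hom(a, b ⊗ c)`. -/
def IsCGMap (a : Matrix ι ι A) (b : Matrix κ κ A) (c : Matrix μ μ A)
    (Φ : Matrix ι ι ℂ →ₗ[ℂ] Matrix κ κ ℂ) : Prop :=
  ∃ V : Matrix (κ × μ) ι ℂ, V.conjTranspose * V = 1 ∧ IsIntertwiner a (repTensor b c) V ∧
    ∀ X, Φ X = partialQTrace (qMatrix c) (V * X * V.conjTranspose)

end Rep

end CQG

end

/-! In Kac type every Q-matrix is the identity (`IsQMatrix.eq_one`), so `d_u` is the matrix size of
`u` and the conjugate of `u` is the entrywise adjoint `u^c`, itself unitary. This unitarity lets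
tensor legs be moved across an intertwiner without any twist: Frobenius reciprocity, combined with
adjoints and an equivalence `c' ≅ c^c`, identifies `Hom(c', a^c ⊗ b)`, `Hom(b, a ⊗ c')` and `Hom(a,
b ⊗ c)` up to conjugation. By Schur's lemma and the multiplicity hypothesis they are lines, and a
nonzero element of the last two rescales to an isometry.

For part 1, cut `V : H_a → H_b ⊗ H_c` into slices `V_m`, so that `Φ(X) = ∑ V_m X V_m*`. The trace
adjoint has Kraus operators `V_m*`, which are the slices of an intertwiner `b → a ⊗ c^c`
(`traceAdjoint_eq_partialQTrace`). Rotated into `a ⊗ c'`, it is `r` times the isometry `W` defining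
`Ψ`, so `Φ* = |r|² Ψ`; taking traces at the identity yields `|r|² = d_a / d_b` for any choice of `V`
and `W`.

For part 2, covariance says that the matrix of `Φ` intertwines `u ⊗ u^c` with `v ⊗ v^c`, a condition
stable under adjoints. Complete positivity passes to the adjoint because the positive cone is
self-dual, and trace preservation is dual to unitality. Schur's lemma makes `Φ(1)` scalar, which
fixes the normalisation `d_β / d_α`. -/

noncomputable section

namespace CQG

universe u v

set_option linter.unusedSectionVars false

/-! ### Intertwiners, Schur's lemma and multiplicity one. -/

section Intertwiners

variable {A : Type u} [CStarAlgebra A]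
variable {ι κ μ ν : Type} [Fintype ι] [DecidableEq ι] [Fintype κ] [DecidableEq κ]
  [Fintype μ] [DecidableEq μ] [Fintype ν] [DecidableEq ν]

theorem scalarMat_mul (X : Matrix κ ι ℂ) (Y : Matrix ι μ ℂ) :
    scalarMat A (X * Y) = scalarMat A X * scalarMat A Y :=
  Matrix.map_mul

theorem scalarMat_one : scalarMat A (1 : Matrix ι ι ℂ) = 1 :=
  Matrix.map_one _ (map_zero _) (map_one _)

theorem scalarMat_smul (c : ℂ) (X : Matrix κ ι ℂ) :
    scalarMat A (c • X) = c • scalarMat A X := by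
  ext i j; simp [scalarMat, Algebra.smul_def]

theorem star_scalarMat (X : Matrix κ ι ℂ) :
    (scalarMat A X).conjTranspose = scalarMat A X.conjTranspose := by
  ext i j
  simpa [scalarMat] using (algebraMap_star_comm (A := A) (X j i)).symm

theorem mul_scalarMat_apply (u : Matrix κ ι A) (T : Matrix ι μ ℂ) (k : κ) (m : μ) :
    (u * scalarMat A T) k m = ∑ i, T i m • u k i := by
  simp [Matrix.mul_apply, scalarMat, Algebra.smul_def, Algebra.commutes]

theorem scalarMat_mul_apply (T : Matrix κ ι ℂ) (u : Matrix ι μ A) (k : κ) (m : μ) :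
    (scalarMat A T * u) k m = ∑ i, T k i • u i m := by
  simp [Matrix.mul_apply, scalarMat, Algebra.smul_def]

theorem isIntertwiner_iff {u : Matrix ι ι A} {v : Matrix κ κ A} {T : Matrix κ ι ℂ} :
    IsIntertwiner u v T ↔ ∀ k i, ∑ l, T l i • v k l = ∑ j, T k j • u j i := by
  rw [IsIntertwiner, ← Matrix.ext_iff]
  simp only [mul_scalarMat_apply, scalarMat_mul_apply]

theorem IsIntertwiner.comp {u : Matrix ι ι A} {v : Matrix κ κ A} {w : Matrix μ μ A}
    {S : Matrix μ κ ℂ} {T : Matrix κ ι ℂ} (hS : IsIntertwiner v w S) (hT : IsIntertwiner u v T) :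
    IsIntertwiner u w (S * T) := by
  unfold IsIntertwiner at *
  rw [scalarMat_mul, ← Matrix.mul_assoc, hS, Matrix.mul_assoc, hT, Matrix.mul_assoc]

theorem IsIntertwiner.smul {u : Matrix ι ι A} {v : Matrix κ κ A} {T : Matrix κ ι ℂ}
    (hT : IsIntertwiner u v T) (c : ℂ) : IsIntertwiner u v (c • T) := by
  unfold IsIntertwiner at *
  rw [scalarMat_smul, Matrix.mul_smul, hT, Matrix.smul_mul]

theorem IsIntertwiner.adjoint {u : Matrix ι ι A} {v : Matrix κ κ A} {T : Matrix κ ι ℂ}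
    (hu : u ∈ unitary (Matrix ι ι A)) (hv : v ∈ unitary (Matrix κ κ A))
    (hT : IsIntertwiner u v T) : IsIntertwiner v u T.conjTranspose := by
  have h := congrArg Matrix.conjTranspose hT
  rw [Matrix.conjTranspose_mul, Matrix.conjTranspose_mul, star_scalarMat] at h
  have hu' : u * u.conjTranspose = 1 := Unitary.mul_star_self_of_mem hu
  have hv' : v.conjTranspose * v = 1 := Unitary.star_mul_self_of_mem hv
  unfold IsIntertwiner
  calc u * scalarMat A T.conjTranspose
      = u * (scalarMat A T.conjTranspose * v.conjTranspose) * v := by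
        rw [Matrix.mul_assoc, Matrix.mul_assoc, hv', Matrix.mul_one]
    _ = scalarMat A T.conjTranspose * v := by
        rw [h, ← Matrix.mul_assoc, hu', Matrix.one_mul]

theorem IsIntertwiner.inverse {u : Matrix ι ι A} {v : Matrix κ κ A} {T : Matrix κ ι ℂ}
    {S : Matrix ι κ ℂ} (hT : IsIntertwiner u v T) (hTS : T * S = 1) (hST : S * T = 1) :
    IsIntertwiner v u S := by
  unfold IsIntertwiner at *
  calc u * scalarMat A S = scalarMat A (S * T) * u * scalarMat A S := by
        rw [hST, scalarMat_one, Matrix.one_mul]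
    _ = scalarMat A S * v * scalarMat A (T * S) := by
        rw [scalarMat_mul, Matrix.mul_assoc (scalarMat A S), ← hT, scalarMat_mul]
        simp only [Matrix.mul_assoc]
    _ = _ := by rw [hTS, scalarMat_one, Matrix.mul_one]

theorem RepEquiv.symm {u : Matrix ι ι A} {v : Matrix κ κ A} (h : RepEquiv u v) :
    RepEquiv v u := by
  obtain ⟨T, S, hT, h1, h2⟩ := h
  exact ⟨S, T, hT.inverse h1 h2, h2, h1⟩

/-- `T* T` is a positive nonzero self-intertwiner of `u`, hence a scalar `r > 0`; divide `T` by
`√r`. -/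
theorem IsIrreducible.exists_isometry {u : Matrix ι ι A} {v : Matrix κ κ A}
    (hi : IsIrreducible u) (hu : u ∈ unitary (Matrix ι ι A)) (hv : v ∈ unitary (Matrix κ κ A))
    {T : Matrix κ ι ℂ} (hT : IsIntertwiner u v T) (h0 : T ≠ 0) :
    ∃ V : Matrix κ ι ℂ, V.conjTranspose * V = 1 ∧ IsIntertwiner u v V := by
  obtain ⟨c, hc⟩ := hi.2 _ ((hT.adjoint hu hv).comp hT)
  obtain ⟨i⟩ := hi.1
  have hpos : 0 ≤ c := by
    have := (Matrix.posSemidef_conjTranspose_mul_self T).diag_nonneg (i := i)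
    rw [hc] at this
    simpa using this
  have hne : c ≠ 0 := by
    rintro rfl
    rw [zero_smul, Matrix.conjTranspose_mul_self_eq_zero] at hc
    exact h0 hc
  obtain ⟨r, rfl⟩ : ∃ r : ℝ, c = r := ⟨c.re, by
    apply Complex.ext
    · simp
    · simpa using (Complex.nonneg_iff.1 hpos).2.symm⟩
  have hr : 0 < r := lt_of_le_of_ne (by exact_mod_cast hpos) (by rintro rfl; exact hne (by simp))
  refine ⟨((Real.sqrt r)⁻¹ : ℂ) • T, ?_, hT.smul _⟩
  rw [Matrix.conjTranspose_smul, Matrix.smul_mul, Matrix.mul_smul, hc, smul_smul, smul_smul]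
  have : star ((Real.sqrt r)⁻¹ : ℂ) * ((Real.sqrt r : ℂ)⁻¹ * r) = 1 := by
    simp only [star_inv₀, Complex.star_def, Complex.conj_ofReal]
    norm_cast
    field_simp
    rw [Real.sq_sqrt hr.le]
  rw [mul_assoc, this, one_smul]

/-- Schur's lemma: a nonzero intertwiner of irreducible unitary representations is invertible. -/
theorem IsIrreducible.repEquiv_of_ne_zero {u : Matrix ι ι A} {v : Matrix κ κ A}
    (hiu : IsIrreducible u) (hiv : IsIrreducible v)
    (hu : u ∈ unitary (Matrix ι ι A)) (hv : v ∈ unitary (Matrix κ κ A))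
    {T : Matrix κ ι ℂ} (hT : IsIntertwiner u v T) (h0 : T ≠ 0) : RepEquiv u v := by
  obtain ⟨V, hV1, hV⟩ := hiu.exists_isometry hu hv hT h0
  obtain ⟨c, hc⟩ := hiv.2 _ (hV.comp (hV.adjoint hu hv))
  refine ⟨V, V.conjTranspose, hV, ?_, hV1⟩
  have hne : V ≠ 0 := by
    rintro rfl
    obtain ⟨i⟩ := hiu.1
    simpa using congrFun (congrFun hV1 i) i
  -- `V V* = c` and `V* V = 1` force `c = 1`, so the isometry is already unitary.
  have : c • V = V := by
    calc c • V = (V * V.conjTranspose) * V := by rw [hc, Matrix.smul_mul, Matrix.one_mul]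
      _ = V := by rw [Matrix.mul_assoc, hV1, Matrix.mul_one]
  have hc1 : c = 1 := by
    have h : (c - 1) • V = 0 := by rw [sub_smul, this, one_smul, sub_self]
    rcases smul_eq_zero.1 h with h | h
    · exact sub_eq_zero.1 h
    · exact absurd h hne
  rw [hc, hc1, one_smul]

/-- Composing with the inverse of an equivalence turns every intertwiner into a self-intertwiner of
`u`, that is, a scalar. -/
theorem RepEquiv.intertwiner_unique {u : Matrix ι ι A} {v : Matrix κ κ A} (hiu : IsIrreducible u)
    (h : RepEquiv u v) {T T' : Matrix κ ι ℂ} (hT : IsIntertwiner u v T)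
    (hT' : IsIntertwiner u v T') (h0 : T ≠ 0) : ∃ c : ℂ, T' = c • T := by
  obtain ⟨R, S, hR, hRS, hSR⟩ := h
  have hS := hR.inverse hRS hSR
  have key : ∀ X : Matrix κ ι ℂ, IsIntertwiner u v X → ∃ c : ℂ, X = c • R := by
    intro X hX
    obtain ⟨c, hc⟩ := hiu.2 _ (hS.comp hX)
    refine ⟨c, ?_⟩
    calc X = R * (S * X) := by rw [← Matrix.mul_assoc, hRS, Matrix.one_mul]
      _ = c • R := by rw [hc, Matrix.mul_smul, Matrix.mul_one]
  obtain ⟨c, rfl⟩ := key T hT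
  obtain ⟨d, rfl⟩ := key T' hT'
  have hc : c ≠ 0 := by rintro rfl; simp at h0
  exact ⟨d / c, by rw [smul_smul, div_mul_cancel₀ _ hc]⟩

/-- If `u` occurs once in `v`, then `Hom(u, v)` is one-dimensional. -/
theorem OccursOnce.intertwiner_unique {G : CompactQuantumGroup A} {u : Matrix ι ι A}
    {v : Matrix κ κ A} (hu : IsIrrep G u) (h : OccursOnce G u v) :
    (∃ T : Matrix κ ι ℂ, IsIntertwiner u v T ∧ T ≠ 0) ∧
      ∀ T T' : Matrix κ ι ℂ, IsIntertwiner u v T → IsIntertwiner u v T' → T ≠ 0 →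
        ∃ c : ℂ, T' = c • T := by
  obtain ⟨N, n, w, hw, ⟨R, S, hR, hRS, hSR⟩, j, hj, huniq⟩ := h
  have hS := hR.inverse hRS hSR
  have hblock : ∀ (B : Matrix (Σ j, Fin (n j)) ι ℂ),
      IsIntertwiner u (Matrix.blockDiagonal' w) B ↔
        ∀ l, IsIntertwiner u (w l) (Matrix.of fun x i => B ⟨l, x⟩ i) := by
    intro B
    simp only [isIntertwiner_iff, Sigma.forall, Fintype.sum_sigma, Matrix.of_apply]
    refine forall_congr' fun l => forall_congr' fun x => forall_congr' fun i => ?_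
    rw [Finset.sum_eq_single l]
    · simp [Matrix.blockDiagonal'_apply_eq]
    · intro b _ hb
      refine Finset.sum_eq_zero fun y _ => ?_
      rw [Matrix.blockDiagonal'_apply_ne _ _ _ (Ne.symm hb), smul_zero]
    · simp
  -- By Schur's lemma only the block equivalent to `u` can receive a nonzero component.
  have hzero : ∀ (B : Matrix (Σ j, Fin (n j)) ι ℂ), IsIntertwiner u (Matrix.blockDiagonal' w) B →
      ∀ l, l ≠ j → (Matrix.of fun x i => B ⟨l, x⟩ i : Matrix (Fin (n l)) ι ℂ) = 0 := by
    intro B hB l hl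
    by_contra hne
    exact hl (huniq l (hu.2.repEquiv_of_ne_zero (hw l).2 hu.1.2 (hw l).1.2 ((hblock B).1 hB l) hne))
  constructor
  · obtain ⟨E, F, hE, hEF, hFE⟩ := hj
    have hEne : E ≠ 0 := by
      rintro rfl
      obtain ⟨i⟩ := hu.2.1
      simpa using congrFun (congrFun hFE i) i
    classical
    -- The equivalence with the block `j`, extended by zero to the other blocks.
    let B : Matrix (Σ j, Fin (n j)) ι ℂ :=
      Matrix.of fun p i => if h : p.1 = j then E (h ▸ p.2) i else 0
    have hBj : (Matrix.of fun x i => B ⟨j, x⟩ i : Matrix (Fin (n j)) ι ℂ) = E := by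
      ext x i; simp [B]
    have hB : IsIntertwiner u (Matrix.blockDiagonal' w) B := by
      rw [hblock]
      intro l
      by_cases hl : l = j
      · subst hl
        rw [hBj]; exact hE
      · have : (Matrix.of fun x i => B ⟨l, x⟩ i : Matrix (Fin (n l)) ι ℂ) = 0 := by
          ext x i; simp [B, hl]
        rw [this, isIntertwiner_iff]
        simp
    refine ⟨S * B, hS.comp hB, fun h => hEne ?_⟩
    have hB0 : B = 0 := by
      calc B = R * (S * B) := by rw [← Matrix.mul_assoc, hRS, Matrix.one_mul]
        _ = 0 := by rw [h, Matrix.mul_zero]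
    rw [← hBj, hB0]
    rfl
  · intro T T' hT hT' h0
    have hB := hR.comp hT
    have hB' := hR.comp hT'
    have hne : (Matrix.of fun x i => (R * T) ⟨j, x⟩ i : Matrix (Fin (n j)) ι ℂ) ≠ 0 := by
      intro hz
      apply h0
      have : R * T = 0 := by
        ext ⟨l, x⟩ i
        by_cases hl : l = j
        · subst hl
          exact congrFun (congrFun hz x) i
        · exact congrFun (congrFun (hzero _ hB l hl) x) i
      calc T = S * (R * T) := by rw [← Matrix.mul_assoc, hSR, Matrix.one_mul]
        _ = 0 := by rw [this, Matrix.mul_zero]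
    obtain ⟨c, hc⟩ := hj.intertwiner_unique hu.2 ((hblock _).1 hB j) ((hblock _).1 hB' j) hne
    refine ⟨c, ?_⟩
    have : R * T' = c • (R * T) := by
      ext ⟨l, x⟩ i
      by_cases hl : l = j
      · subst hl
        exact congrFun (congrFun hc x) i
      · have h1 := congrFun (congrFun (hzero _ hB l hl) x) i
        have h2 := congrFun (congrFun (hzero _ hB' l hl) x) i
        simp only [Matrix.of_apply, Matrix.zero_apply] at h1 h2
        rw [Matrix.smul_apply, h1, h2, smul_zero]
    calc T' = S * (R * T') := by rw [← Matrix.mul_assoc, hSR, Matrix.one_mul]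
      _ = c • T := by rw [this, Matrix.mul_smul, ← Matrix.mul_assoc, hSR, Matrix.one_mul]

end Intertwiners

/-! ### Kac type: trivial Q-matrices and unitary contragredients. -/

section Kac

variable {A : Type u} [CStarAlgebra A]
variable {ι κ μ ν : Type} [Fintype ι] [DecidableEq ι] [Fintype κ] [DecidableEq κ]
  [Fintype μ] [DecidableEq μ] [Fintype ν] [DecidableEq ν]

open scoped MatrixOrder in
theorem conjugateBy_one (u : Matrix ι ι A) : conjugateBy 1 u = contragredient u := by
  rw [conjugateBy, CFC.sqrt_one, inv_one, scalarMat_one, Matrix.one_mul, Matrix.mul_one]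

-- `qMatrix` is an arbitrary choice among Q-matrices, so the Kac hypothesis only becomes usable once
-- 1 is known to be the sole candidate. Unitarity of both `w = u^c` and `Q^{1/2} w Q^{-1/2}` makes
-- `Q` and `Q⁻¹` self-intertwiners of `w`. The trace condition then gives `Tr Q² = Tr 1 = Tr Q⁻²`,
-- so `Q - Q⁻¹` has Hilbert–Schmidt norm 0.
open scoped MatrixOrder in
theorem IsQMatrix.eq_one {u : Matrix ι ι A} {Q : Matrix ι ι ℂ} (h1 : IsQMatrix u 1)
    (hQ : IsQMatrix u Q) : Q = 1 := by
  obtain ⟨-, hw, -⟩ := h1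
  rw [conjugateBy_one] at hw
  obtain ⟨hpos, hun, htr⟩ := hQ
  have hQ0 : 0 ≤ Q := Matrix.nonneg_iff_posSemidef.2 hpos.posSemidef
  rw [conjugateBy] at hun
  set w := contragredient u
  set P := CFC.sqrt Q with hP
  have hPP : P * P = Q := CFC.sqrt_mul_sqrt_self Q
  have hPs : P.conjTranspose = P := (Matrix.nonneg_iff_posSemidef.1 (CFC.sqrt_nonneg Q)).1
  have hQu : IsUnit Q.det := (Matrix.isUnit_iff_isUnit_det Q).1 hpos.isUnit
  have hPu : IsUnit P.det := by
    rw [← hPP, Matrix.det_mul] at hQu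
    exact isUnit_of_mul_isUnit_left hQu
  have hPi : P * P⁻¹ = 1 := Matrix.mul_nonsing_inv P hPu
  have hPi' : P⁻¹ * P = 1 := Matrix.nonsing_inv_mul P hPu
  have hPis : P⁻¹.conjTranspose = P⁻¹ := by rw [Matrix.conjTranspose_nonsing_inv, hPs]
  have hQi : P⁻¹ * P⁻¹ = Q⁻¹ := by rw [← hPP, Matrix.mul_inv_rev]
  have hww : w.conjTranspose * w = 1 := Unitary.star_mul_self_of_mem hw
  have hz := Unitary.mul_star_self_of_mem hun
  have hsi : scalarMat A P⁻¹ * scalarMat A P = 1 := by rw [← scalarMat_mul, hPi', scalarMat_one]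
  have hsi' : scalarMat A P * scalarMat A P⁻¹ = 1 := by rw [← scalarMat_mul, hPi, scalarMat_one]
  rw [Matrix.star_eq_conjTranspose, Matrix.conjTranspose_mul, Matrix.conjTranspose_mul,
    star_scalarMat, star_scalarMat, hPs, hPis] at hz
  have hint : IsIntertwiner w w Q⁻¹ := by
    unfold IsIntertwiner
    rw [← hQi, scalarMat_mul]
    set s := scalarMat A P
    set t := scalarMat A P⁻¹
    -- The bracket is the product of the conjugated matrix with its adjoint, equal to 1 by `hz`; in
    -- effect `w Q⁻¹ w* = Q⁻¹`.
    calc w * (t * t) = t * (s * w * t * (t * (w.conjTranspose * s))) * t * w := by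
          have e : t * (s * w * t * (t * (w.conjTranspose * s))) * t * w
            = (t * s) * (w * t * t) * w.conjTranspose * (s * t) * w := by
            simp only [Matrix.mul_assoc]
          rw [e, hsi, hsi', Matrix.one_mul, Matrix.mul_one, Matrix.mul_assoc _ _ w, hww,
            Matrix.mul_one, Matrix.mul_assoc]
      _ = t * t * w := by rw [hz, Matrix.mul_one]
  have hint' : IsIntertwiner w w Q :=
    hint.inverse (Matrix.nonsing_inv_mul Q hQu) (Matrix.mul_nonsing_inv Q hQu)
  have e1 := htr _ hint
  have e2 := htr _ hint'
  rw [Matrix.mul_nonsing_inv Q hQu] at e1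
  rw [Matrix.nonsing_inv_mul Q hQu] at e2
  have hQs : Q.conjTranspose = Q := hpos.1
  have hQis : Q⁻¹.conjTranspose = Q⁻¹ := by rw [Matrix.conjTranspose_nonsing_inv, hQs]
  have h0 : ((Q - Q⁻¹).conjTranspose * (Q - Q⁻¹)).trace = 0 := by
    rw [Matrix.conjTranspose_sub, hQs, hQis, sub_mul, mul_sub, mul_sub,
      Matrix.mul_nonsing_inv Q hQu, Matrix.nonsing_inv_mul Q hQu]
    simp only [Matrix.trace_sub]
    rw [e2, ← e1]
    ring
  have h3 : Q = Q⁻¹ := sub_eq_zero.1 (Matrix.trace_conjTranspose_mul_self_eq_zero_iff.1 h0)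
  have hQQ : Q * Q = 1 := by
    conv_lhs => rw [h3]
    nth_rewrite 2 [← h3]
    exact Matrix.nonsing_inv_mul Q hQu
  -- A positive matrix is the positive square root of its square, here of 1.
  rw [← CFC.sqrt_mul_self Q, hQQ, CFC.sqrt_one]

theorem IsKac.qMatrix_eq_one {G : CompactQuantumGroup A} (hG : IsKac G) {u : Matrix ι ι A}
    (hu : IsUnitaryRep G u) : qMatrix u = 1 :=
  (hG ι u hu).eq_one (Classical.epsilon_spec (p := IsQMatrix u) ⟨1, hG ι u hu⟩)

theorem IsKac.quantumDim_eq {G : CompactQuantumGroup A} (hG : IsKac G) {u : Matrix ι ι A}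
    (hu : IsUnitaryRep G u) : quantumDim u = Fintype.card ι := by
  rw [quantumDim, hG.qMatrix_eq_one hu, Matrix.trace_one]

theorem IsKac.conjugateRep_eq {G : CompactQuantumGroup A} (hG : IsKac G) {u : Matrix ι ι A}
    (hu : IsUnitaryRep G u) : conjugateRep u = contragredient u := by
  rw [conjugateRep, hG.qMatrix_eq_one hu, conjugateBy_one]

theorem IsKac.contragredient_mem {G : CompactQuantumGroup A} (hG : IsKac G) {u : Matrix ι ι A}
    (hu : IsUnitaryRep G u) : contragredient u ∈ unitary (Matrix ι ι A) := by
  have := (hG ι u hu).2.1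
  rwa [conjugateBy_one] at this

/-! ### Unitarity of tensor products and Frobenius reciprocity. -/

theorem sum_star_mul_of_mem_unitary {u : Matrix ι ι A} (hu : u ∈ unitary (Matrix ι ι A)) (i j : ι) :
    ∑ k, star (u k i) * u k j = (1 : Matrix ι ι A) i j := by
  rw [← Unitary.star_mul_self_of_mem hu]
  rfl

theorem sum_mul_star_of_mem_unitary {u : Matrix ι ι A} (hu : u ∈ unitary (Matrix ι ι A)) (i j : ι) :
    ∑ k, u i k * star (u j k) = (1 : Matrix ι ι A) i j := by
  rw [← Unitary.mul_star_self_of_mem hu]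
  rfl

theorem repTensor_mem_unitary {u : Matrix ι ι A} {v : Matrix κ κ A}
    (hu : u ∈ unitary (Matrix ι ι A)) (hv : v ∈ unitary (Matrix κ κ A)) :
    repTensor u v ∈ unitary (Matrix (ι × κ) (ι × κ) A) := by
  rw [Unitary.mem_iff]
  constructor
  · ext ⟨i, k⟩ ⟨j, l⟩
    simp only [Matrix.mul_apply, Matrix.star_apply, repTensor, Matrix.kroneckerMap_apply, star_mul,
      Fintype.sum_prod_type]
    -- The entries do not commute: the two factors from `u` stand next to each other in `v* u* u v`,
    -- so their index must be summed first.
    rw [Finset.sum_comm]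
    have : ∀ y, ∑ x, star (v y k) * star (u x i) * (u x j * v y l)
        = star (v y k) * (1 : Matrix ι ι A) i j * v y l := by
      intro y
      rw [← sum_star_mul_of_mem_unitary hu, Finset.mul_sum, Finset.sum_mul]
      simp only [mul_assoc]
    simp only [this]
    by_cases h : i = j
    · subst h
      simp only [Matrix.one_apply_eq, mul_one, sum_star_mul_of_mem_unitary hv]
      simp [Matrix.one_apply]
    · simp [h]
  · ext ⟨i, k⟩ ⟨j, l⟩
    simp only [Matrix.mul_apply, Matrix.star_apply, repTensor, Matrix.kroneckerMap_apply, star_mul,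
      Fintype.sum_prod_type]
    have : ∀ x, ∑ y, u i x * v k y * (star (v l y) * star (u j x))
        = u i x * (1 : Matrix κ κ A) k l * star (u j x) := by
      intro y
      rw [← sum_mul_star_of_mem_unitary hv, Finset.mul_sum, Finset.sum_mul]
      simp only [mul_assoc]
    simp only [this]
    by_cases h : k = l
    · subst h
      simp only [Matrix.one_apply_eq, mul_one, sum_mul_star_of_mem_unitary hu]
      simp [Matrix.one_apply]
    · simp [h]

/-- Frobenius reciprocity `Hom(a, b ⊗ c) → Hom(a ⊗ c^c, b)`. -/
theorem IsIntertwiner.moveRight {a : Matrix ι ι A} {b : Matrix κ κ A} {c : Matrix μ μ A}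
    (hc : contragredient c ∈ unitary (Matrix μ μ A)) {V : Matrix (κ × μ) ι ℂ}
    (hV : IsIntertwiner a (repTensor b c) V) :
    IsIntertwiner (repTensor a (contragredient c)) b
      (Matrix.of fun k (p : ι × μ) => V (k, p.2) p.1) := by
  rw [isIntertwiner_iff] at hV ⊢
  rintro k ⟨i, m⟩
  simp only [Fintype.sum_prod_type, Matrix.of_apply, repTensor, Matrix.kroneckerMap_apply,
    contragredient, Matrix.map_apply] at hV ⊢
  -- This relation, with the star on the right in a sum over row indices, is unitarity of `c^c`, not
  -- of `c`. The calculation inserts it as an identity and then absorbs `b ⊗ c` by the intertwining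
  -- property.
  have hδ : ∀ m', ∑ n, c n m' * star (c n m) = (1 : Matrix μ μ A) m' m := by
    intro m'
    simpa [contragredient] using sum_star_mul_of_mem_unitary hc m' m
  calc ∑ l, V (l, m) i • b k l
      = ∑ l, ∑ m', V (l, m') i • (b k l * (1 : Matrix μ μ A) m' m) := by
        refine Finset.sum_congr rfl fun l _ => ?_
        rw [Finset.sum_eq_single m]
        · simp
        · intro m' _ h; simp [h]
        · simp
    _ = ∑ n, (∑ l, ∑ m', V (l, m') i • (b k l * c n m')) * star (c n m) := by
        simp only [← hδ, Finset.mul_sum, Finset.sum_mul, Finset.smul_sum, smul_mul_assoc, mul_assoc]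
        exact (Finset.sum_comm.trans (Finset.sum_congr rfl fun l _ => Finset.sum_comm)).symm
    _ = ∑ n, ∑ j, V (k, n) j • (a j i * star (c n m)) := by
        refine Finset.sum_congr rfl fun n _ => ?_
        rw [hV (k, n) i, Finset.sum_mul]
        simp only [smul_mul_assoc]
    _ = _ := Finset.sum_comm

/-- Frobenius reciprocity `Hom(a ⊗ c^c, b) → Hom(a, b ⊗ c)`. -/
theorem IsIntertwiner.of_moveRight {a : Matrix ι ι A} {b : Matrix κ κ A} {c : Matrix μ μ A}
    (hc : contragredient c ∈ unitary (Matrix μ μ A)) {S : Matrix κ (ι × μ) ℂ}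
    (hS : IsIntertwiner (repTensor a (contragredient c)) b S) :
    IsIntertwiner a (repTensor b c) (Matrix.of fun (p : κ × μ) i => S p.1 (i, p.2)) := by
  rw [isIntertwiner_iff] at hS ⊢
  rintro ⟨k, m⟩ i
  simp only [Fintype.sum_prod_type, Prod.forall, Matrix.of_apply, repTensor,
    Matrix.kroneckerMap_apply, contragredient, Matrix.map_apply] at hS ⊢
  have hδ : ∀ n, ∑ m', star (c n m') * c m m' = (1 : Matrix μ μ A) n m := by
    intro n
    simpa [contragredient] using sum_mul_star_of_mem_unitary hc n m
  calc ∑ l, ∑ m', S l (i, m') • (b k l * c m m')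
      = ∑ m', (∑ l, S l (i, m') • b k l) * c m m' := by
        rw [Finset.sum_comm]
        simp only [Finset.sum_mul, smul_mul_assoc]
    _ = ∑ m', ∑ j, ∑ n, S k (j, n) • (a j i * (star (c n m') * c m m')) := by
        simp only [hS, Finset.sum_mul, smul_mul_assoc, mul_assoc]
    _ = ∑ j, ∑ n, S k (j, n) • (a j i * (1 : Matrix μ μ A) n m) := by
        simp only [← hδ, Finset.mul_sum, Finset.smul_sum]
        exact Finset.sum_comm.trans (Finset.sum_congr rfl fun l _ => Finset.sum_comm)
    _ = ∑ j, S k (j, m) • a j i := by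
        refine Finset.sum_congr rfl fun j _ => ?_
        rw [Finset.sum_eq_single m]
        · simp
        · intro n _ h; simp [h]
        · simp

/-- Frobenius reciprocity `Hom(c, a^c ⊗ b) → Hom(a ⊗ c, b)`. -/
theorem IsIntertwiner.moveLeft {a : Matrix ι ι A} {b : Matrix κ κ A} {c : Matrix μ μ A}
    (ha : contragredient a ∈ unitary (Matrix ι ι A)) {T : Matrix (ι × κ) μ ℂ}
    (hT : IsIntertwiner c (repTensor (contragredient a) b) T) :
    IsIntertwiner (repTensor a c) b (Matrix.of fun k (p : ι × μ) => T (p.1, k) p.2) := by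
  rw [isIntertwiner_iff] at hT ⊢
  rintro k ⟨i, m⟩
  simp only [Fintype.sum_prod_type, Prod.forall, Matrix.of_apply, repTensor,
    Matrix.kroneckerMap_apply, contragredient, Matrix.map_apply] at hT ⊢
  have hδ : ∀ q, ∑ j, a j i * star (a j q) = (1 : Matrix ι ι A) i q := by
    intro q
    simpa [contragredient] using sum_star_mul_of_mem_unitary ha i q
  symm
  calc ∑ j, ∑ n, T (j, k) n • (a j i * c n m)
      = ∑ j, a j i * ∑ n, T (j, k) n • c n m := by
        simp only [Finset.mul_sum, mul_smul_comm]
    _ = ∑ j, ∑ q, ∑ l, T (q, l) m • (a j i * star (a j q) * b k l) := by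
        simp only [← hT, Finset.mul_sum, mul_smul_comm, mul_assoc]
    _ = ∑ q, ∑ l, T (q, l) m • ((1 : Matrix ι ι A) i q * b k l) := by
        simp only [← hδ, Finset.sum_mul, Finset.smul_sum]
        exact Finset.sum_comm.trans (Finset.sum_congr rfl fun l _ => Finset.sum_comm)
    _ = ∑ l, T (i, l) m • b k l := by
        rw [Finset.sum_eq_single i]
        · simp
        · intro n _ h; simp [h.symm]
        · simp

/-- Frobenius reciprocity `Hom(a ⊗ c, b) → Hom(c, a^c ⊗ b)`. -/
theorem IsIntertwiner.of_moveLeft {a : Matrix ι ι A} {b : Matrix κ κ A} {c : Matrix μ μ A}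
    (ha : contragredient a ∈ unitary (Matrix ι ι A)) {S : Matrix κ (ι × μ) ℂ}
    (hS : IsIntertwiner (repTensor a c) b S) :
    IsIntertwiner c (repTensor (contragredient a) b)
      (Matrix.of fun (p : ι × κ) m => S p.2 (p.1, m)) := by
  rw [isIntertwiner_iff] at hS ⊢
  rintro ⟨p, k⟩ m
  simp only [Fintype.sum_prod_type, Prod.forall, Matrix.of_apply, repTensor,
    Matrix.kroneckerMap_apply, contragredient, Matrix.map_apply] at hS ⊢
  have hδ : ∀ q, ∑ j, star (a p j) * a q j = (1 : Matrix ι ι A) p q := by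
    intro q
    simpa [contragredient] using sum_mul_star_of_mem_unitary ha p q
  calc ∑ j, ∑ l, S l (j, m) • (star (a p j) * b k l)
      = ∑ j, star (a p j) * ∑ l, S l (j, m) • b k l := by
        simp only [Finset.mul_sum, mul_smul_comm]
    _ = ∑ j, ∑ q, ∑ n, S k (q, n) • (star (a p j) * a q j * c n m) := by
        simp only [hS, Finset.mul_sum, mul_smul_comm, mul_assoc]
    _ = ∑ q, ∑ n, S k (q, n) • ((1 : Matrix ι ι A) p q * c n m) := by
        simp only [← hδ, Finset.sum_mul, Finset.smul_sum]
        exact Finset.sum_comm.trans (Finset.sum_congr rfl fun l _ => Finset.sum_comm)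
    _ = ∑ n, S k (p, n) • c n m := by
        rw [Finset.sum_eq_single p]
        · simp
        · intro n _ h; simp [h.symm]
        · simp

/-- `1 ⊗ T` intertwines `a ⊗ c` and `a ⊗ d` when `T` intertwines `c` and `d`. -/
theorem IsIntertwiner.one_kronecker (a : Matrix ι ι A) {c : Matrix μ μ A} {d : Matrix ν ν A}
    {T : Matrix ν μ ℂ} (hT : IsIntertwiner c d T) :
    IsIntertwiner (repTensor a c) (repTensor a d) ((1 : Matrix ι ι ℂ) ⊗ₖ T) := by
  rw [isIntertwiner_iff] at hT ⊢
  rintro ⟨i, m⟩ ⟨j, n⟩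
  simp only [Fintype.sum_prod_type, repTensor, Matrix.kroneckerMap_apply]
  rw [Finset.sum_eq_single j, Finset.sum_eq_single i]
  · simp only [Matrix.one_apply_eq, one_mul, ← mul_smul_comm, ← Finset.mul_sum, hT]
  · intro b _ hb
    simp [hb.symm]
  · simp
  · intro b _ hb
    simp [hb]
  · simp

end Kac

/-! ### Covariant maps, complete positivity and the trace adjoint. -/

section Covariant

variable {A : Type u} [CStarAlgebra A]
variable {ι κ μ ν : Type} [Fintype ι] [DecidableEq ι] [Fintype κ] [DecidableEq κ]
  [Fintype μ] [DecidableEq μ] [Fintype ν] [DecidableEq ν]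

theorem sum_sum_comm {α β γ δ M : Type*} [Fintype α] [Fintype β] [Fintype γ] [Fintype δ]
    [AddCommMonoid M] (f : α → β → γ → δ → M) :
    ∑ a, ∑ b, ∑ c, ∑ d, f a b c d = ∑ c, ∑ d, ∑ a, ∑ b, f a b c d := by
  have : ∑ p : α × β, ∑ q : γ × δ, f p.1 p.2 q.1 q.2 =
      ∑ q : γ × δ, ∑ p : α × β, f p.1 p.2 q.1 q.2 := Finset.sum_comm
  simpa only [Fintype.sum_prod_type] using this

theorem mul_scalarMat_mul_star_apply (u : Matrix ι ι A) (X : Matrix ι ι ℂ) (i j : ι) :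
    (u * scalarMat A X * star u) i j = ∑ p, ∑ q, X p q • (u i p * star (u j q)) := by
  rw [Matrix.mul_apply]
  simp only [mul_scalarMat_apply, Matrix.star_apply, Finset.sum_mul, smul_mul_assoc]
  exact Finset.sum_comm

theorem linearMap_apply_eq_sum (Φ : Matrix ι ι ℂ →ₗ[ℂ] Matrix κ κ ℂ) (X : Matrix ι ι ℂ) (k l : κ) :
    Φ X k l = ∑ i, ∑ j, X i j * Φ (Matrix.single i j 1) k l := by
  conv_lhs => rw [Matrix.matrix_eq_sum_single X]
  simp only [map_sum, Matrix.sum_apply]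
  refine Finset.sum_congr rfl fun i _ => Finset.sum_congr rfl fun j _ => ?_
  have h : Matrix.single i j (X i j) = X i j • Matrix.single i j (1 : ℂ) := by simp
  rw [h, map_smul, Matrix.smul_apply, smul_eq_mul]

/-- The matrix of `Φ` in the bases of matrix units. -/
def superoperatorMatrix (Φ : Matrix ι ι ℂ →ₗ[ℂ] Matrix κ κ ℂ) : Matrix (κ × κ) (ι × ι) ℂ :=
  Matrix.of fun p q => Φ (Matrix.single q.1 q.2 1) p.1 p.2

/-- On vectorised matrices, `X ↦ u (X ⊗ 1) u*` acts through the coefficients `u_ip u_jq*`, which are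
the entries of `u ⊗ u^c`. Comparing coefficients of `X` turns covariance into the intertwining
relation. -/
theorem isCovariant_iff_isIntertwiner {u : Matrix ι ι A} {v : Matrix κ κ A}
    {Φ : Matrix ι ι ℂ →ₗ[ℂ] Matrix κ κ ℂ} :
    IsCovariant u v Φ ↔ IsIntertwiner (repTensor u (contragredient u))
      (repTensor v (contragredient v)) (superoperatorMatrix Φ) := by
  have h1 : ∀ X k l, tensorId Φ (u * scalarMat A X * star u) k l =
      ∑ p, ∑ q, X p q • ∑ i, ∑ j, Φ (Matrix.single i j 1) k l • (u i p * star (u j q)) := by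
    intro X k l
    simp only [tensorId, mul_scalarMat_mul_star_apply, Finset.smul_sum]
    rw [sum_sum_comm]
    simp only [smul_comm (X _ _)]
  have h2 : ∀ X k l, (v * scalarMat A (Φ X) * star v) k l =
      ∑ p, ∑ q, X p q • ∑ m, ∑ n, Φ (Matrix.single p q 1) m n • (v k m * star (v l n)) := by
    intro X k l
    simp only [mul_scalarMat_mul_star_apply]
    simp only [linearMap_apply_eq_sum Φ X, Finset.smul_sum, Finset.sum_smul, mul_smul]
    rw [sum_sum_comm]
  rw [isIntertwiner_iff]
  simp only [Prod.forall, Fintype.sum_prod_type, superoperatorMatrix, Matrix.of_apply, repTensor,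
    Matrix.kroneckerMap_apply, contragredient, Matrix.map_apply]
  constructor
  · intro h k l p q
    have e := congrFun (congrFun (h (Matrix.single p q 1)) k) l
    rw [h1, h2] at e
    have hs : ∀ f : ι → ι → A, ∑ i, ∑ j, (Matrix.single p q (1 : ℂ)) i j • f i j = f p q := by
      intro f
      rw [Finset.sum_eq_single p, Finset.sum_eq_single q]
      · simp
      · intro b _ hb; simp [hb.symm]
      · simp
      · intro b _ hb; simp [hb.symm]
      · simp
    rw [hs, hs] at e
    exact e.symm
  · intro h X
    ext k l
    rw [h1, h2]
    simp only [h]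

theorem traceAdjoint_single (Φ : Matrix ι ι ℂ →ₗ[ℂ] Matrix κ κ ℂ) (k l : κ) (i j : ι) :
    traceAdjoint Φ (Matrix.single k l 1) i j = Φ (Matrix.single j i 1) l k := by
  simp [traceAdjoint, Matrix.trace_single_mul]

theorem traceAdjoint_traceAdjoint (Φ : Matrix ι ι ℂ →ₗ[ℂ] Matrix κ κ ℂ) :
    traceAdjoint (traceAdjoint Φ) = Φ := by
  apply LinearMap.ext
  intro X
  ext k l
  rw [linearMap_apply_eq_sum, linearMap_apply_eq_sum Φ]
  simp only [traceAdjoint_single]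

/-- The star reverses products, sending `u_ip u_jq*` to `u_jq u_ip*`: the same entries of `u ⊗ u^c`
with both legs exchanged. -/
theorem IsIntertwiner.star_swap {u : Matrix ι ι A} {v : Matrix κ κ A}
    {C : Matrix (κ × κ) (ι × ι) ℂ}
    (hC : IsIntertwiner (repTensor u (contragredient u)) (repTensor v (contragredient v)) C) :
    IsIntertwiner (repTensor u (contragredient u)) (repTensor v (contragredient v))
      (Matrix.of fun p q => star (C p.swap q.swap)) := by
  rw [isIntertwiner_iff] at hC ⊢
  rintro ⟨k, l⟩ ⟨p, q⟩
  have h := congrArg star (hC (l, k) (q, p))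
  simp only [Fintype.sum_prod_type, repTensor, Matrix.kroneckerMap_apply, contragredient,
    Matrix.map_apply, star_sum, star_smul, star_mul, star_star, Matrix.of_apply,
    Prod.swap_prod_mk] at h ⊢
  rw [Finset.sum_comm, h, Finset.sum_comm]

/-- The matrix of `Φ*` is the transpose of that of `Φ` with legs exchanged, i.e. the conjugate
transpose of the matrix in `IsIntertwiner.star_swap`. Taking the adjoint intertwiner needs `u ⊗ u^c`
and `v ⊗ v^c` unitary, which is where Kac type enters. -/
theorem IsCovariant.traceAdjoint {u : Matrix ι ι A} {v : Matrix κ κ A}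
    (hu : u ∈ unitary (Matrix ι ι A)) (hu' : contragredient u ∈ unitary (Matrix ι ι A))
    (hv : v ∈ unitary (Matrix κ κ A)) (hv' : contragredient v ∈ unitary (Matrix κ κ A))
    {Φ : Matrix ι ι ℂ →ₗ[ℂ] Matrix κ κ ℂ} (h : IsCovariant u v Φ) :
    IsCovariant v u (traceAdjoint Φ) := by
  rw [isCovariant_iff_isIntertwiner] at h ⊢
  have := h.star_swap.adjoint (repTensor_mem_unitary hu hu') (repTensor_mem_unitary hv hv')
  convert this using 1
  ext ⟨i, j⟩ ⟨k, l⟩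
  simp [superoperatorMatrix, traceAdjoint_single]

theorem IsCovariant.smul {u : Matrix ι ι A} {v : Matrix κ κ A}
    {Φ : Matrix ι ι ℂ →ₗ[ℂ] Matrix κ κ ℂ} (h : IsCovariant u v Φ) (c : ℂ) :
    IsCovariant u v (c • Φ) := by
  rw [isCovariant_iff_isIntertwiner] at h ⊢
  exact h.smul c

theorem traceAdjoint_smul (c : ℂ) (Φ : Matrix ι ι ℂ →ₗ[ℂ] Matrix κ κ ℂ) :
    traceAdjoint (c • Φ) = c • traceAdjoint Φ := by
  apply LinearMap.ext
  intro Y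
  ext i j
  simp [traceAdjoint]

theorem IsCP.smul {Φ : Matrix ι ι ℂ →ₗ[ℂ] Matrix κ κ ℂ} (h : IsCP Φ) {c : ℂ} (hc : 0 ≤ c) :
    IsCP (c • Φ) := fun n M hM => (h n M hM).smul hc

/-- Over `ℂ` a real-valued quadratic form already forces the matrix to be Hermitian. -/
theorem posSemidef_of_dotProduct_mulVec_nonneg {M : Matrix ι ι ℂ}
    (h : ∀ x : ι → ℂ, 0 ≤ star x ⬝ᵥ M.mulVec x) : M.PosSemidef := by
  rw [← Matrix.isPositive_toEuclideanLin_iff, LinearMap.isPositive_iff_complex]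
  intro x
  have hx := h x.ofLp
  have e : inner ℂ (M.toEuclideanLin x) x = star (star x.ofLp ⬝ᵥ M.mulVec x.ofLp) := by
    rw [← Matrix.star_dotProduct_star, star_star, EuclideanSpace.inner_eq_star_dotProduct,
      dotProduct_comm]
    rfl
  obtain ⟨r, hr⟩ : ∃ r : ℝ, star x.ofLp ⬝ᵥ M.mulVec x.ofLp = r :=
    ⟨_, Complex.ext rfl (Complex.nonneg_iff.1 hx).2.symm⟩
  rw [hr] at hx
  rw [e, hr]
  simpa using hx

open scoped MatrixOrder in
theorem trace_mul_nonneg_of_posSemidef {M N : Matrix ι ι ℂ} (hM : M.PosSemidef)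
    (hN : N.PosSemidef) : 0 ≤ (M * N).trace := by
  classical
  obtain ⟨B, rfl⟩ := CStarAlgebra.nonneg_iff_eq_star_mul_self.1 (Matrix.nonneg_iff_posSemidef.2 hM)
  rw [Matrix.star_eq_conjTranspose]
  rw [Matrix.trace_mul_comm, ← Matrix.mul_assoc, Matrix.trace_mul_comm, ← Matrix.mul_assoc]
  exact (hN.mul_mul_conjTranspose_same B).trace_nonneg

/-- By duality `⟨w, (id ⊗ Φ*)(N) w⟩ = Tr(N (id ⊗ Φ)(w w*))`, the trace of a product of two positive
matrices. -/
theorem IsCP.traceAdjoint {Φ : Matrix ι ι ℂ →ₗ[ℂ] Matrix κ κ ℂ} (h : IsCP Φ) :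
    IsCP (traceAdjoint Φ) := by
  intro n N hN
  refine posSemidef_of_dotProduct_mulVec_nonneg fun w => ?_
  have h1 := trace_mul_nonneg_of_posSemidef hN
    (h n _ (Matrix.posSemidef_vecMulVec_self_star w))
  convert h1 using 1
  have h2 : ∀ x y : Fin n, ∑ i, ∑ j, star (w (x, i)) *
      (CQG.traceAdjoint Φ (Matrix.of fun k l => N (x, k) (y, l)) i j * w (y, j)) =
      ∑ k, ∑ l, N (x, k) (y, l) *
        Φ (Matrix.of fun i j => w (y, i) * star (w (x, j))) l k := by
    intro x y
    have := trace_traceAdjoint_mul Φ (Matrix.of fun k l => N (x, k) (y, l))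
      (Matrix.of fun i j => w (y, i) * star (w (x, j)))
    simp only [Matrix.trace, Matrix.diag_apply, Matrix.mul_apply, Matrix.of_apply] at this
    rw [← this]
    refine Finset.sum_congr rfl fun i _ => Finset.sum_congr rfl fun j _ => ?_
    ring
  simp only [dotProduct, Matrix.mulVec, Matrix.trace, Matrix.diag_apply, Matrix.mul_apply,
    Fintype.sum_prod_type, Matrix.of_apply, Pi.star_apply, Finset.mul_sum, Matrix.vecMulVec_apply]
  refine Finset.sum_congr rfl fun x _ => ?_
  rw [Finset.sum_comm]
  conv_rhs => rw [Finset.sum_comm]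
  exact Finset.sum_congr rfl fun y _ => h2 x y

theorem isCP_traceAdjoint_iff {Φ : Matrix ι ι ℂ →ₗ[ℂ] Matrix κ κ ℂ} :
    IsCP (traceAdjoint Φ) ↔ IsCP Φ :=
  ⟨fun h => traceAdjoint_traceAdjoint Φ ▸ h.traceAdjoint, IsCP.traceAdjoint⟩

theorem isTP_iff_traceAdjoint_one {Φ : Matrix ι ι ℂ →ₗ[ℂ] Matrix κ κ ℂ} :
    IsTP Φ ↔ traceAdjoint Φ 1 = 1 := by
  rw [Matrix.ext_iff_trace_mul_right]
  simp only [trace_traceAdjoint_mul, one_mul, IsTP]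

/-- Covariance at `X = 1`, where `u u* = 1`, says that `Φ(1)` commutes with `v`; Schur's lemma
applies. -/
theorem IsCovariant.map_one {u : Matrix ι ι A} {v : Matrix κ κ A}
    (hu : u ∈ unitary (Matrix ι ι A)) (hv : v ∈ unitary (Matrix κ κ A)) (hiv : IsIrreducible v)
    {Φ : Matrix ι ι ℂ →ₗ[ℂ] Matrix κ κ ℂ} (h : IsCovariant u v Φ) : ∃ c : ℂ, Φ 1 = c • 1 := by
  apply hiv.2
  have e := h 1
  rw [scalarMat_one, Matrix.mul_one, Unitary.mul_star_self_of_mem hu] at e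
  have e2 : tensorId Φ (1 : Matrix ι ι A) = scalarMat A (Φ 1) := by
    ext k l
    rw [scalarMat, Matrix.map_apply, linearMap_apply_eq_sum]
    simp [tensorId, Matrix.one_apply, Algebra.smul_def]
  rw [e2] at e
  unfold IsIntertwiner
  calc v * scalarMat A (Φ 1) = v * scalarMat A (Φ 1) * (star v * v) := by
        rw [Unitary.star_mul_self_of_mem hv, Matrix.mul_one]
    _ = scalarMat A (Φ 1) * v := by rw [← Matrix.mul_assoc, ← e]

/-- With `Φ(1) = c`, one has `Tr Φ*(Y) = Tr(Y Φ(1)) = c Tr Y`, and `Tr Φ(1) = Tr 1` gives `c |κ| =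
|ι|`. The prefactor is thus `1/c`. -/
theorem IsTP.smul_traceAdjoint {u : Matrix ι ι A} {v : Matrix κ κ A} [Nonempty ι]
    (hu : u ∈ unitary (Matrix ι ι A)) (hv : v ∈ unitary (Matrix κ κ A)) (hiv : IsIrreducible v)
    {Φ : Matrix ι ι ℂ →ₗ[ℂ] Matrix κ κ ℂ} (h : IsCovariant u v Φ) (htp : IsTP Φ) :
    IsTP (((Fintype.card κ : ℂ) / Fintype.card ι) • traceAdjoint Φ) := by
  obtain ⟨c, hc⟩ := h.map_one hu hv hiv
  have hcard := htp 1
  rw [hc, Matrix.trace_smul, Matrix.trace_one, Matrix.trace_one, smul_eq_mul] at hcard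
  intro Y
  have := trace_traceAdjoint_mul Φ Y 1
  rw [Matrix.mul_one, hc, Matrix.mul_smul, Matrix.mul_one, Matrix.trace_smul, smul_eq_mul] at this
  have hne : (Fintype.card ι : ℂ) ≠ 0 := by exact_mod_cast Fintype.card_ne_zero
  rw [LinearMap.smul_apply, Matrix.trace_smul, this, smul_eq_mul]
  field_simp
  linear_combination Y.trace * hcard

theorem smul_traceAdjoint_mem_CPTPCov {u : Matrix ι ι A} {v : Matrix κ κ A} [Nonempty ι]
    (hu : u ∈ unitary (Matrix ι ι A)) (hu' : contragredient u ∈ unitary (Matrix ι ι A))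
    (hv : v ∈ unitary (Matrix κ κ A)) (hv' : contragredient v ∈ unitary (Matrix κ κ A))
    (hiv : IsIrreducible v) {Φ : Matrix ι ι ℂ →ₗ[ℂ] Matrix κ κ ℂ} (h : Φ ∈ CPTPCov u v) :
    ((Fintype.card κ : ℂ) / Fintype.card ι) • traceAdjoint Φ ∈ CPTPCov v u := by
  obtain ⟨h1, h2, h3⟩ := h
  refine ⟨h1.traceAdjoint.smul ?_, h2.smul_traceAdjoint hu hv hiv h3,
    (h3.traceAdjoint hu hu' hv hv').smul _⟩
  have : (0 : ℝ) ≤ (Fintype.card κ : ℝ) / Fintype.card ι := by positivity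
  simpa using Complex.zero_le_real.2 this

end Covariant

/-! ### Clebsch–Gordan maps and their Kraus operators. -/

section ClebschGordan

variable {A : Type u} [CStarAlgebra A]
variable {ι κ μ ν : Type} [Fintype ι] [DecidableEq ι] [Fintype κ] [DecidableEq κ]
  [Fintype μ] [DecidableEq μ] [Fintype ν] [DecidableEq ν]

theorem partialQTrace_one_apply (Z : Matrix (ι × κ) (ι × κ) ℂ) (i j : ι) :
    partialQTrace 1 Z i j = ∑ m, Z (i, m) (j, m) := by
  simp [partialQTrace, Matrix.trace]

theorem trace_partialQTrace_one (Z : Matrix (ι × κ) (ι × κ) ℂ) :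
    (partialQTrace 1 Z).trace = Z.trace := by
  simp only [Matrix.trace, Matrix.diag_apply, partialQTrace_one_apply, Fintype.sum_prod_type]

theorem partialQTrace_add (Q : Matrix κ κ ℂ) (Y Z : Matrix (ι × κ) (ι × κ) ℂ) :
    partialQTrace Q (Y + Z) = partialQTrace Q Y + partialQTrace Q Z := by
  ext i j
  simp [partialQTrace, Matrix.trace, Matrix.mul_apply, mul_add, Finset.sum_add_distrib]

theorem partialQTrace_smul (Q : Matrix κ κ ℂ) (c : ℂ) (Z : Matrix (ι × κ) (ι × κ) ℂ) :
    partialQTrace Q (c • Z) = c • partialQTrace Q Z := by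
  ext i j
  simp [partialQTrace, Matrix.trace, Matrix.mul_apply, Finset.mul_sum, mul_left_comm]

/-- Cyclicity of the trace on the traced-out leg. It allows `c^c` to be replaced by an equivalent
`c'` without changing the map. -/
theorem partialQTrace_one_kronecker_conj {S : Matrix ν μ ℂ} {t : ℂ}
    (hS : S.conjTranspose * S = t • 1) (Z : Matrix (ι × μ) (ι × μ) ℂ) :
    partialQTrace 1 (((1 : Matrix ι ι ℂ) ⊗ₖ S) * Z * ((1 : Matrix ι ι ℂ) ⊗ₖ S).conjTranspose) =
      t • partialQTrace 1 Z := by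
  ext i j
  have h1 : ∀ n m, ((1 : Matrix ι ι ℂ) ⊗ₖ S * Z) (i, n) (j, m) = ∑ p, S n p * Z (i, p) (j, m) := by
    intro n m
    rw [Matrix.mul_apply, Fintype.sum_prod_type, Finset.sum_eq_single i]
    · simp
    · intro b _ hb; simp [hb.symm]
    · simp
  have h2 : ∀ n, (((1 : Matrix ι ι ℂ) ⊗ₖ S) * Z * ((1 : Matrix ι ι ℂ) ⊗ₖ S).conjTranspose)
      (i, n) (j, n) = ∑ m, ∑ p, S n p * Z (i, p) (j, m) * star (S n m) := by
    intro n
    rw [Matrix.mul_apply, Fintype.sum_prod_type, Finset.sum_eq_single j]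
    · simp [h1, Finset.sum_mul]
    · intro b _ hb; simp [hb.symm]
    · simp
  have h3 : ∀ m p, ∑ n, star (S n m) * S n p = t * (1 : Matrix μ μ ℂ) m p := by
    intro m p
    simpa [Matrix.mul_apply] using congrFun (congrFun hS m) p
  rw [Matrix.smul_apply, partialQTrace_one_apply, partialQTrace_one_apply]
  simp only [h2]
  calc ∑ n, ∑ m, ∑ p, S n p * Z (i, p) (j, m) * star (S n m)
      = ∑ m, ∑ p, Z (i, p) (j, m) * ∑ n, star (S n m) * S n p := by
        rw [Finset.sum_comm]
        refine Finset.sum_congr rfl fun m _ => ?_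
        rw [Finset.sum_comm]
        refine Finset.sum_congr rfl fun p _ => ?_
        rw [Finset.mul_sum]
        exact Finset.sum_congr rfl fun n _ => by ring
    _ = t • ∑ m, Z (i, m) (j, m) := by
        simp only [h3, Finset.smul_sum]
        refine Finset.sum_congr rfl fun m _ => ?_
        rw [Finset.sum_eq_single m]
        · simp [mul_comm]
        · intro b _ hb; simp [hb.symm]
        · simp

theorem exists_isCGMap {a : Matrix ι ι A} {b : Matrix κ κ A} {c : Matrix μ μ A}
    {V : Matrix (κ × μ) ι ℂ} (h1 : V.conjTranspose * V = 1)
    (hV : IsIntertwiner a (repTensor b c) V) : ∃ Φ, IsCGMap a b c Φ :=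
  ⟨{  toFun := fun X => partialQTrace (qMatrix c) (V * X * V.conjTranspose)
      map_add' := fun X Y => by rw [Matrix.mul_add, Matrix.add_mul, partialQTrace_add]
      map_smul' := fun r X => by
        rw [Matrix.mul_smul, Matrix.smul_mul, partialQTrace_smul, RingHom.id_apply] },
    V, h1, hV, fun _ => rfl⟩

theorem isTP_of_isometry {V : Matrix (κ × μ) ι ℂ} (h1 : V.conjTranspose * V = 1)
    {Φ : Matrix ι ι ℂ →ₗ[ℂ] Matrix κ κ ℂ}
    (hΦ : ∀ X, Φ X = partialQTrace 1 (V * X * V.conjTranspose)) : IsTP Φ := by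
  intro X
  rw [hΦ, trace_partialQTrace_one, Matrix.trace_mul_comm, ← Matrix.mul_assoc, h1, Matrix.one_mul]

/-- The transpose `H_β → H_α ⊗ H_γ̄` of `V : H_α → H_β ⊗ H_γ`. -/
def frobeniusDual (V : Matrix (κ × μ) ι ℂ) : Matrix (ι × μ) κ ℂ :=
  Matrix.of fun p k => star (V (k, p.2) p.1)

/-- `Φ` has the slices `V_m` of `V` as Kraus operators, so its trace adjoint has `V_m*`, and these
are the slices of `frobeniusDual V`. -/
theorem traceAdjoint_eq_partialQTrace {V : Matrix (κ × μ) ι ℂ}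
    {Φ : Matrix ι ι ℂ →ₗ[ℂ] Matrix κ κ ℂ}
    (hΦ : ∀ X, Φ X = partialQTrace 1 (V * X * V.conjTranspose)) (Y : Matrix κ κ ℂ) :
    traceAdjoint Φ Y =
      partialQTrace 1 (frobeniusDual V * Y * (frobeniusDual V).conjTranspose) := by
  have hs : ∀ (i j : ι) k l, Φ (Matrix.single j i 1) l k =
      ∑ m, V (l, m) j * star (V (k, m) i) := by
    intro i j k l
    rw [hΦ, partialQTrace_one_apply]
    refine Finset.sum_congr rfl fun m _ => ?_
    rw [Matrix.mul_apply, Finset.sum_eq_single i]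
    · simp
    · intro b _ hb; simp [hb]
    · simp
  ext i j
  rw [partialQTrace_one_apply]
  simp only [traceAdjoint, LinearMap.coe_mk, AddHom.coe_mk, Matrix.of_apply, Matrix.trace,
    Matrix.diag_apply, Matrix.mul_apply, hs, frobeniusDual, Matrix.conjTranspose_apply, star_star,
    Finset.mul_sum, Finset.sum_mul]
  rw [Finset.sum_comm]
  conv_rhs => rw [Finset.sum_comm]
  refine Finset.sum_congr rfl fun l _ => ?_
  rw [Finset.sum_comm]
  refine Finset.sum_congr rfl fun m _ => Finset.sum_congr rfl fun k _ => ?_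
  ring

theorem IsIntertwiner.frobeniusDual {a : Matrix ι ι A} {b : Matrix κ κ A} {c : Matrix μ μ A}
    (ha : a ∈ unitary (Matrix ι ι A)) (hb : b ∈ unitary (Matrix κ κ A))
    (hc : contragredient c ∈ unitary (Matrix μ μ A)) {V : Matrix (κ × μ) ι ℂ}
    (hV : IsIntertwiner a (repTensor b c) V) :
    IsIntertwiner b (repTensor a (contragredient c)) (frobeniusDual V) :=
  (hV.moveRight hc).adjoint (repTensor_mem_unitary ha hc) hb

/-- Schur's lemma rescales the equivalence to an isometry; being proportional to an invertible
matrix, it is unitary. -/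
theorem RepEquiv.exists_unitary {u : Matrix ι ι A} {v : Matrix κ κ A}
    (hiu : IsIrreducible u) (hu : u ∈ unitary (Matrix ι ι A)) (hv : v ∈ unitary (Matrix κ κ A))
    (h : RepEquiv u v) : ∃ (T : Matrix κ ι ℂ), IsIntertwiner u v T ∧
      T.conjTranspose * T = 1 ∧ T * T.conjTranspose = 1 := by
  obtain ⟨R, S, hR, hRS, hSR⟩ := h
  have hne : R ≠ 0 := by
    rintro rfl
    obtain ⟨i⟩ := hiu.1
    simpa using congrFun (congrFun hSR i) i
  obtain ⟨T, hT1, hT⟩ := hiu.exists_isometry hu hv hR hne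
  obtain ⟨c, hc⟩ := RepEquiv.intertwiner_unique hiu ⟨R, S, hR, hRS, hSR⟩ hR hT hne
  refine ⟨T, hT, hT1, ?_⟩
  have h2 : c • T.conjTranspose * R = 1 := by
    rw [Matrix.smul_mul, ← Matrix.mul_smul, ← hc, hT1]
  have h3 : c • T.conjTranspose = S := by
    calc c • T.conjTranspose = c • T.conjTranspose * R * S := by
          rw [Matrix.mul_assoc, hRS, Matrix.mul_one]
      _ = S := by rw [h2, Matrix.one_mul]
  rw [hc, Matrix.smul_mul, ← Matrix.mul_smul, ← hc, h3, hRS]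

/-- If `c` is equivalent to a conjugate occurring once in `a^c ⊗ b`, then `Hom(b, a ⊗ c)` has
dimension at most one. -/
theorem intertwiner_unique_of_occursOnce {G : CompactQuantumGroup A} {a : Matrix ι ι A}
    {b : Matrix κ κ A} {c : Matrix μ μ A} (ha : a ∈ unitary (Matrix ι ι A))
    (hb : b ∈ unitary (Matrix κ κ A)) (hc : IsIrrep G c)
    (ha' : contragredient a ∈ unitary (Matrix ι ι A))
    (h : OccursOnce G c (repTensor (contragredient a) b)) {W W' : Matrix (ι × μ) κ ℂ}
    (hW : IsIntertwiner b (repTensor a c) W) (hW' : IsIntertwiner b (repTensor a c) W')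
    (h0 : W ≠ 0) : ∃ r : ℂ, W' = r • W := by
  have hac := repTensor_mem_unitary ha hc.1.2
  obtain ⟨r, hr⟩ := (h.intertwiner_unique hc).2 _ _ ((hW.adjoint hb hac).of_moveLeft ha')
    ((hW'.adjoint hb hac).of_moveLeft ha') (by
      intro hz
      apply h0
      ext ⟨i, m⟩ k
      simpa using congrFun (congrFun hz (i, k)) m)
  -- The passage to `Hom(c, a^c ⊗ b)` goes through the adjoint, so it conjugates scalars.
  refine ⟨star r, ?_⟩
  ext ⟨i, m⟩ k
  have := congrArg star (congrFun (congrFun hr (i, k)) m)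
  simpa [mul_comm] using this

end ClebschGordan

/-! ### Existence and adjoints of Clebsch–Gordan maps in Kac type. -/

theorem IsKac.exists_isCGMap {A : Type u} [CStarAlgebra A] {G : CompactQuantumGroup A}
    (hG : IsKac G)
    {ι κ μ ν : Type} [Fintype ι] [DecidableEq ι] [Fintype κ] [DecidableEq κ]
    [Fintype μ] [DecidableEq μ] [Fintype ν] [DecidableEq ν]
    {a : Matrix ι ι A} {b : Matrix κ κ A} {c : Matrix μ μ A} {c' : Matrix ν ν A}
    (ha : IsIrrep G a) (hb : IsIrrep G b) (hc : IsIrrep G c) (hc' : IsIrrep G c')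
    (he : RepEquiv c' (contragredient c))
    (ho : OccursOnce G c' (repTensor (contragredient a) b)) :
    (∃ Φ, IsCGMap a b c Φ) ∧ ∃ Ψ, IsCGMap b a c' Ψ := by
  have ha' := hG.contragredient_mem ha.1
  have hcc := hG.contragredient_mem hc.1
  obtain ⟨T, hT, hT0⟩ := (ho.intertwiner_unique hc').1
  have hS := hT.moveLeft ha'
  set S : Matrix κ (ι × ν) ℂ := Matrix.of fun k p => T (p.1, k) p.2 with hSdef
  have hS0 : S.conjTranspose ≠ 0 := by
    intro hz
    apply hT0
    ext ⟨i, k⟩ m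
    simpa [hSdef] using congrFun (congrFun hz (i, m)) k
  have hS' := hS.adjoint (repTensor_mem_unitary ha.1.2 hc'.1.2) hb.1.2
  obtain ⟨W, hW1, hW⟩ := hb.2.exists_isometry hb.1.2 (repTensor_mem_unitary ha.1.2 hc'.1.2) hS' hS0
  refine ⟨?_, CQG.exists_isCGMap hW1 hW⟩
  obtain ⟨U, hU, hU1, hU2⟩ := he.exists_unitary hc'.2 hc'.1.2 hcc
  -- The nonzero element of `Hom(b, a ⊗ c')` is rotated by `U` into `a ⊗ c^c`, and its adjoint is
  -- transposed into `Hom(a, b ⊗ c)`.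
  have hX := (hU.one_kronecker a).comp hS'
  have hV := (hX.adjoint hb.1.2 (repTensor_mem_unitary ha.1.2 hcc)).of_moveRight hcc
  set X := (1 : Matrix ι ι ℂ) ⊗ₖ U * S.conjTranspose with hXdef
  have hX0 : X ≠ 0 := by
    intro hz
    apply hS0
    have : ((1 : Matrix ι ι ℂ) ⊗ₖ U.conjTranspose) * X = S.conjTranspose := by
      rw [hXdef, ← Matrix.mul_assoc, ← Matrix.mul_kronecker_mul, hU1, Matrix.one_mul,
        Matrix.one_kronecker_one, Matrix.one_mul]
    rw [← this, hz, Matrix.mul_zero]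
  obtain ⟨V, hV1, hV'⟩ := ha.2.exists_isometry ha.1.2 (repTensor_mem_unitary hb.1.2 hc.1.2) hV (by
    intro hz
    apply hX0
    ext ⟨i, m⟩ k
    simpa using congrFun (congrFun hz (k, m)) i)
  exact CQG.exists_isCGMap hV1 hV'

theorem IsKac.traceAdjoint_of_isCGMap {A : Type u} [CStarAlgebra A] {G : CompactQuantumGroup A}
    (hG : IsKac G)
    {ι κ μ ν : Type} [Fintype ι] [DecidableEq ι] [Fintype κ] [DecidableEq κ]
    [Fintype μ] [DecidableEq μ] [Fintype ν] [DecidableEq ν]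
    {a : Matrix ι ι A} {b : Matrix κ κ A} {c : Matrix μ μ A} {c' : Matrix ν ν A}
    (ha : IsIrrep G a) (hb : IsIrrep G b) (hc : IsIrrep G c) (hc' : IsIrrep G c')
    (he : RepEquiv c' (contragredient c))
    (ho : OccursOnce G c' (repTensor (contragredient a) b))
    {Φ : Matrix ι ι ℂ →ₗ[ℂ] Matrix κ κ ℂ} {Ψ : Matrix κ κ ℂ →ₗ[ℂ] Matrix ι ι ℂ}
    (hΦ : IsCGMap a b c Φ) (hΨ : IsCGMap b a c' Ψ) :
    traceAdjoint Φ = ((Fintype.card ι : ℂ) / Fintype.card κ) • Ψ := by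
  have ha' := hG.contragredient_mem ha.1
  have hcc := hG.contragredient_mem hc.1
  obtain ⟨V, hV1, hV, hΦ⟩ := hΦ
  obtain ⟨W, hW1, hW, hΨ⟩ := hΨ
  simp only [hG.qMatrix_eq_one hc.1] at hΦ
  simp only [hG.qMatrix_eq_one hc'.1] at hΨ
  obtain ⟨k⟩ := id hb.2.1
  have hW0 : W ≠ 0 := by
    rintro rfl
    simpa using congrFun (congrFun hW1 k) k
  obtain ⟨U, hU, hU1, hU2⟩ := he.exists_unitary hc'.2 hc'.1.2 hcc
  -- The dual of `V`, rotated by `1 ⊗ U*`, lies on the same line `Hom(b, a ⊗ c')` as `W`.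
  have hE := ((hU.adjoint hc'.1.2 hcc).one_kronecker a).comp (hV.frobeniusDual ha.1.2 hb.1.2 hcc)
  obtain ⟨r, hr⟩ := intertwiner_unique_of_occursOnce ha.1.2 hb.1.2 hc' ha' ho hW hE hW0
  have key : ∀ Y, traceAdjoint Φ Y = (r * star r) • Ψ Y := by
    intro Y
    have hU2' : U.conjTranspose.conjTranspose * U.conjTranspose = (1 : ℂ) • 1 := by
      rw [Matrix.conjTranspose_conjTranspose, hU2, one_smul]
    have e := partialQTrace_one_kronecker_conj (ι := ι) hU2'
      (frobeniusDual V * Y * (frobeniusDual V).conjTranspose)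
    rw [one_smul, ← traceAdjoint_eq_partialQTrace hΦ] at e
    rw [← e, hΨ, ← partialQTrace_smul]
    congr 1
    calc _ = ((1 : Matrix ι ι ℂ) ⊗ₖ U.conjTranspose * frobeniusDual V) * Y *
          ((1 : Matrix ι ι ℂ) ⊗ₖ U.conjTranspose * frobeniusDual V).conjTranspose := by
          simp only [Matrix.conjTranspose_mul, Matrix.mul_assoc]
      _ = _ := by
          rw [hr, Matrix.conjTranspose_smul, Matrix.smul_mul, Matrix.smul_mul, Matrix.mul_smul,
            smul_smul]
  -- `Φ*` is unital and `Ψ` preserves traces, so traces at 1 give `|ι| = |r|² |κ|`.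
  have h1 := congrArg Matrix.trace (key 1)
  rw [isTP_iff_traceAdjoint_one.1 (isTP_of_isometry hV1 hΦ), Matrix.trace_smul,
    isTP_of_isometry hW1 hΨ, Matrix.trace_one, Matrix.trace_one, smul_eq_mul] at h1
  have : Nonempty κ := ⟨k⟩
  have hne : (Fintype.card κ : ℂ) ≠ 0 := by exact_mod_cast Fintype.card_ne_zero
  apply LinearMap.ext
  intro Y
  rw [key, LinearMap.smul_apply, h1, mul_div_cancel_right₀ _ hne]

end CQG

end

/-! ### The theorem. -/

theorem mainTheorem6 {A : Type*} [CStarAlgebra A] [Nontrivial A]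
    (G : CQG.CompactQuantumGroup A) (hG : CQG.IsKac G) :
    -- the adjoint of a Clebsch-Gordan map
    (∀ (ι κ μ ν : Type) [Fintype ι] [DecidableEq ι] [Fintype κ] [DecidableEq κ]
        [Fintype μ] [DecidableEq μ] [Fintype ν] [DecidableEq ν]
        (a : Matrix ι ι A) (b : Matrix κ κ A) (c : Matrix μ μ A) (c' : Matrix ν ν A),
        CQG.IsIrrep G a → CQG.IsIrrep G b → CQG.IsIrrep G c → CQG.IsIrrep G c' →
        CQG.RepEquiv c' (CQG.conjugateRep c) →
        CQG.OccursOnce G c' (CQG.repTensor (CQG.conjugateRep a) b) →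
        (∃ Φ, CQG.IsCGMap a b c Φ) ∧ (∃ Ψ, CQG.IsCGMap b a c' Ψ) ∧
          ∀ Φ Ψ, CQG.IsCGMap a b c Φ → CQG.IsCGMap b a c' Ψ →
            CQG.traceAdjoint Φ = (CQG.quantumDim a / CQG.quantumDim b) • Ψ) ∧
    -- covariant maps and covariant channels are closed under taking adjoints
    (∀ (ι κ : Type) [Fintype ι] [DecidableEq ι] [Fintype κ] [DecidableEq κ]
        (a : Matrix ι ι A) (b : Matrix κ κ A), CQG.IsIrrep G a → CQG.IsIrrep G b →
        ∀ Φ : Matrix ι ι ℂ →ₗ[ℂ] Matrix κ κ ℂ,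
          (CQG.IsCovariant a b Φ ↔ CQG.IsCovariant b a (CQG.traceAdjoint Φ)) ∧
          (Φ ∈ CQG.CPTPCov a b ↔ CQG.traceAdjoint Φ ∈ CQG.UCPCov b a) ∧
          (Φ ∈ CQG.CPTPCov a b ↔
            (CQG.quantumDim b / CQG.quantumDim a) • CQG.traceAdjoint Φ ∈ CQG.CPTPCov b a)) := by
  constructor
  · intro ι κ μ ν _ _ _ _ _ _ _ _ a b c c' ha hb hc hc' he ho
    rw [hG.conjugateRep_eq hc.1] at he
    rw [hG.conjugateRep_eq ha.1] at ho
    obtain ⟨h1, h2⟩ := hG.exists_isCGMap ha hb hc hc' he ho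
    refine ⟨h1, h2, fun Φ Ψ hΦ hΨ => ?_⟩
    rw [hG.quantumDim_eq ha.1, hG.quantumDim_eq hb.1]
    exact hG.traceAdjoint_of_isCGMap ha hb hc hc' he ho hΦ hΨ
  · intro ι κ _ _ _ _ a b ha hb Φ
    have ha' := hG.contragredient_mem ha.1
    have hb' := hG.contragredient_mem hb.1
    have hcov : CQG.IsCovariant a b Φ ↔ CQG.IsCovariant b a (CQG.traceAdjoint Φ) :=
      ⟨fun h => h.traceAdjoint ha.1.2 ha' hb.1.2 hb', fun h =>
        CQG.traceAdjoint_traceAdjoint Φ ▸ h.traceAdjoint hb.1.2 hb' ha.1.2 ha'⟩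
    have := ha.2.1
    have := hb.2.1
    rw [hG.quantumDim_eq ha.1, hG.quantumDim_eq hb.1]
    refine ⟨hcov, ?_, ?_⟩
    · exact and_congr CQG.isCP_traceAdjoint_iff.symm
        (and_congr CQG.isTP_iff_traceAdjoint_one hcov)
    · refine ⟨CQG.smul_traceAdjoint_mem_CPTPCov ha.1.2 ha' hb.1.2 hb' hb.2, fun h => ?_⟩
      -- The converse is the forward direction applied to the rescaled adjoint: the two factors are
      -- mutually inverse and `Φ** = Φ`.
      have h2 := CQG.smul_traceAdjoint_mem_CPTPCov hb.1.2 hb' ha.1.2 ha' ha.2 h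
      have hι : (Fintype.card ι : ℂ) ≠ 0 := by exact_mod_cast Fintype.card_ne_zero
      have hκ : (Fintype.card κ : ℂ) ≠ 0 := by exact_mod_cast Fintype.card_ne_zero
      rwa [CQG.traceAdjoint_smul, CQG.traceAdjoint_traceAdjoint, smul_smul,
        div_mul_div_cancel₀ hκ, div_self hι, one_smul] at h2
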